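/- **Setting.** Let $\Omega\subseteq\mathbb{R}^d$ and let $K:\Omega\times\Omega\to\mathbb{R}$ be a symmetric positive definite kernel (the kernel matrix of any finitely many pairwise distinct points is positive definite) with $K(x,x)\le 1$ for all $x$ and $K(\cdot,y)$ Borel measurable for all $y$ (for instance, $K$ continuous). Let $\mathcal{H}$ be its reproducing kernel Hilbert space and let $\emptyset\neq\mathcal{A}\subseteq\Omega$ be the set of arms. Fix $\alpha>0$, $q>3/2$, $B>0$, $R\ge 0$ and $\delta\in(0,1)$. *Bandit problem.* For a reward function $f\in\mathcal{H}$ with $\|f\|_{\mathcal{H}}\le B$, in each round $t=1,\dots,T$ the learner selects an arm $x_t\in\mathcal{A}$ and observes $y_t=f(x_t)+\varepsilon_t$. With respect to a filtration $(\mathcal{F}_t)$, $x_t$ is $\mathcal{F}_t$-measurable, $y_t$ is $\mathcal{F}_{t+1}$-measurable, and $\mathbf{E}[\exp(\xi\varepsilon_t)\mid\mathcal{F}_t]\le\exp(\xi^2R^2/2)$ for all $\xi\in\mathbb{R}$. The regret is $R(T)=\sup_{x\in\mathcal{A}}\sum_{t=1}^T(f(x)-f(x_t))$. *$P$-greedy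 algorithm with error $\mathfrak{e}>0$ on $\mathcal{A}$.* Starting with $P_0^2(x)=K(x,x)$, choose for $m=0,1,2,\dots$ a point $\xi_{m+1}\in\operatorname{argmax}_{x\in\mathcal{A}}P_m^2(x)$ and put $$N_{m+1}(x)=\frac{K(x,\xi_{m+1})-\sum_{k=1}^{m}N_k(\xi_{m+1})N_k(x)}{\sqrt{P_m^2(\xi_{m+1})}},\qquad P_{m+1}^2(x)=K(x,x)-\sum_{k=1}^{m+1}N_k(x)^2.$$ Stop at the first $D\ge1$ with $P_D^2(x)<\mathfrak{e}^2$ for all $x\in\mathcal{A}$ and return $N_1,\dots,N_D$. Write $\widetilde{x}=(N_1(x),\dots,N_D(x))^{\mathrm T}$. *APG-UCB with $\lambda=1$.* For time interval $T$, run the $P$-greedy algorithm on $\mathcal{A}$ with $\mathfrak{e}=\alpha/T^q$ and put $\epsilon=B\mathfrak{e}$. For $t=0,\dots,T-1$, the arm $x_{t+1}$ is a maximizer over $x\in\mathcal{A}$ of $$\langle\widetilde{x},\hat\theta_t\rangle+\|\widetilde{x}\|_{A_t^{-1}}(\beta_t+\epsilon\psi_t),$$ where $A_t=1_D+\sum_{s=1}^t\widetilde{x}_s\widetilde{x}_s^{\mathrm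 T}$, $\hat\theta_t=A_t^{-1}\sum_{s=1}^t y_s\widetilde{x}_s$, $\|v\|_M=\sqrt{v^{\mathrm T}Mv}$, $\beta_t=R\sqrt{\log(\det A_t/\delta^2)}+B$ and $\psi_t=\sum_{s=1}^t\|\widetilde{x}_s\|_{A_{s-1}^{-1}}$. Ties in both algorithms may be broken arbitrarily. *Information gain.* Let $\gamma_T=\sup_{x_1,\dots,x_T\in\mathcal{A}}\frac12\log\det\bigl(1_T+(K(x_i,x_j))_{1\le i,j\le T}\bigr)$, and let $\beta_T^{\text{IGP-UCB}}=B+R\sqrt{2(\gamma_T+1+\log(1/\delta))}$. **Theorem.** There is a constant $C\ge0$ (which may depend on $K,\mathcal{A},\alpha,q,B,R,\delta$, but neither on $T$ nor on $f$, the noise, or the run of the algorithm) such that, with $$b(T)=4\beta_T^{\text{IGP-UCB}}\sqrt{\gamma_T T}+C\left(\sqrt{T\gamma_T}\,T^{(3/2-q)/2}+\gamma_T T^{1-q}\right),$$ the following hold. 1. For every $T\ge1$ and every $f\in\mathcal{H}$ with $\|f\|_{\mathcal{H}}\le B$, the regret of APG-UCB satisfies $R(T)\le b(T)$ with probability at least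 $1-\delta$. 2. $b(T)$ is asymptotically equivalent, as $T\to\infty$, to the regret bound $4\beta_T^{\text{IGP-UCB}}\sqrt{\gamma_T(T+2)}$ of IGP-UCB. -/

import Mathlib

open Filter MeasureTheory

noncomputable section

namespace RKHSBandit

/-! ### Kernels and the maximum information gain -/

section Kernel

variable {X : Type*}

/-- A symmetric, positive definite kernel: the kernel matrix of any finitely many pairwise distinct
points is positive definite. -/
def IsPosDefKernel (K : X → X → ℝ) : Prop :=
  (∀ x y, K x y = K y x) ∧
    ∀ (n : ℕ) (x : Fin n → X), Function.Injective x →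
      (Matrix.of fun i j => K (x i) (x j)).PosDef

/-- The information gain `(1/2) log det (1 + lam⁻¹ K_x)` of the points `x 0, …, x (n-1)`, with
`K_x` their kernel matrix. -/
def infoGain (K : X → X → ℝ) (lam : ℝ) {n : ℕ} (x : Fin n → X) : ℝ :=
  1 / 2 * Real.log (1 + lam⁻¹ • Matrix.of fun i j => K (x i) (x j)).det

/-- The maximum information gain `γ_T` over all choices of `T` arms (repetitions allowed). -/
def maxInfoGain (K : X → X → ℝ) (A : Set X) (lam : ℝ) (T : ℕ) : ℝ :=
  ⨆ x : Fin T → A, infoGain K lam fun i => (x i : X)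

end Kernel

/-! ### The `P`-greedy algorithm and the Newton basis (points are indexed from `0`) -/

section PGreedy

variable {X : Type*}

/-- The Newton basis of the points `ξ 0, ξ 1, …`:
`N_m(x) = (K(x, ξ_m) - ∑_{k<m} N_k(ξ_m) N_k(x)) / √(K(ξ_m, ξ_m) - ∑_{k<m} N_k(ξ_m)²)`. -/
def newton (K : X → X → ℝ) (ξ : ℕ → X) (m : ℕ) (x : X) : ℝ :=
  (K x (ξ m) - ∑ k : Fin m, newton K ξ k (ξ m) * newton K ξ k x) /
    √(K (ξ m) (ξ m) - ∑ k : Fin m, newton K ξ k (ξ m) ^ 2)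
termination_by m
decreasing_by all_goals exact k.isLt

/-- `P_m²(x) = K(x, x) - ∑_{k<m} N_k(x)²`, computed from the first `m` points. -/
def powerSq (K : X → X → ℝ) (ξ : ℕ → X) (m : ℕ) (x : X) : ℝ :=
  K x x - ∑ k : Fin m, newton K ξ k x ^ 2

/-- The `P`-greedy algorithm for the kernel `K`, applied to the set `A` with admissible error `e`,
may return the points `ξ 0, …, ξ (D-1)` (ties in the maximizations are broken arbitrarily; the
values `ξ m` with `m ≥ D` play no role). -/
structure IsPGreedyOutput (K : X → X → ℝ) (A : Set X) (e : ℝ) (D : ℕ) (ξ : ℕ → X) : Prop where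
  one_le : 1 ≤ D
  mem : ∀ m < D, ξ m ∈ A
  argmax : ∀ m < D, ∀ x ∈ A, powerSq K ξ m x ≤ powerSq K ξ m (ξ m)
  /-- The stopping test fails after `m = 1, …, D - 1` points. -/
  not_terminated : ∀ m, 1 ≤ m → m < D → ∃ x ∈ A, e ^ 2 ≤ powerSq K ξ m x
  /-- The stopping test succeeds after `D` points. -/
  terminated : ∀ x ∈ A, powerSq K ξ D x < e ^ 2

/-- The feature vector `x̃ = [N_1(x), …, N_D(x)]`. -/
def feature (K : X → X → ℝ) (ξ : ℕ → X) (D : ℕ) (x : X) : Fin D → ℝ :=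
  fun i => newton K ξ i x

end PGreedy

/-! ### The quantities computed by APG-UCB

Here `v : ℕ → Fin D → ℝ` is the sequence of feature vectors of the selected arms and `y : ℕ → ℝ`
the sequence of observed rewards; rounds are numbered from `1`. -/

section LinUCB

variable {D : ℕ}

/-- `A_t = lam 1 + ∑_{s=1}^t v_s v_sᵀ`. -/
def gram (lam : ℝ) (v : ℕ → Fin D → ℝ) (t : ℕ) : Matrix (Fin D) (Fin D) ℝ :=
  lam • 1 + ∑ s ∈ Finset.Icc 1 t, Matrix.vecMulVec (v s) (v s)

/-- `θ̂_t = A_t⁻¹ b_t` with `b_t = ∑_{s=1}^t y_s v_s`. -/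
def thetaHat (lam : ℝ) (v : ℕ → Fin D → ℝ) (y : ℕ → ℝ) (t : ℕ) : Fin D → ℝ :=
  Matrix.mulVec (gram lam v t)⁻¹ (∑ s ∈ Finset.Icc 1 t, y s • v s)

/-- The Mahalanobis norm `‖w‖_M = √(wᵀ M w)`. -/
def mahalanobis (M : Matrix (Fin D) (Fin D) ℝ) (w : Fin D → ℝ) : ℝ :=
  √(w ⬝ᵥ Matrix.mulVec M w)

/-- `ψ_t = ∑_{s=1}^t ‖v_s‖_{A_{s-1}⁻¹}`. -/
def psi (lam : ℝ) (v : ℕ → Fin D → ℝ) (t : ℕ) : ℝ :=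
  ∑ s ∈ Finset.Icc 1 t, mahalanobis (gram lam v (s - 1))⁻¹ (v s)

/-- `β_t = R √(log (det (lam⁻¹ A_t) / δ²)) + √lam B`. -/
def beta (lam R B δ : ℝ) (v : ℕ → Fin D → ℝ) (t : ℕ) : ℝ :=
  R * √(Real.log ((lam⁻¹ • gram lam v t).det / δ ^ 2)) + √lam * B

/-- The upper confidence bound
`⟨w, θ̂_t⟩ + ‖w‖_{A_t⁻¹} (β_t + ε ψ_t)` after round `t`. -/
def ucb (lam R B δ ε : ℝ) (v : ℕ → Fin D → ℝ) (y : ℕ → ℝ) (t : ℕ) (w : Fin D → ℝ) : ℝ :=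
  w ⬝ᵥ thetaHat lam v y t +
    mahalanobis (gram lam v t)⁻¹ w * (beta lam R B δ v t + ε * psi lam v t)

end LinUCB

/-- APG-UCB with arm set `A`, time interval `T`, admissible error `e`, parameters `lam, R, B, δ`,
and Newton basis `N_1, …, N_D` of the points `ξ 0, …, ξ (D-1)` may select the arms
`x 1, …, x T` when it observes the rewards `y 1, …, y T`: in every round it selects a maximizer of
the upper confidence bound with `ε = B e`, ties being broken arbitrarily. -/
def IsAPGUCBRun {X : Type*} (K : X → X → ℝ) (A : Set X) (T : ℕ) (e lam R B δ : ℝ)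
    (D : ℕ) (ξ : ℕ → X) (x : ℕ → X) (y : ℕ → ℝ) : Prop :=
  ∀ t < T, x (t + 1) ∈ A ∧ ∀ z ∈ A,
    ucb lam R B δ (B * e) (fun s => feature K ξ D (x s)) y t (feature K ξ D z) ≤
      ucb lam R B δ (B * e) (fun s => feature K ξ D (x s)) y t (feature K ξ D (x (t + 1)))

/-! ### The stochastic bandit problem -/

/-- The stochastic bandit interaction with reward function `f` over the rounds `1, …, T`: the arm
`x t` is `ℱ t`-measurable, the reward `y t = f (x t) + η t` is `ℱ (t+1)`-measurable, and the noise
`η t` is conditionally `R`-sub-Gaussian given `ℱ t`. -/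
structure IsStochasticBandit {X W : Type*} [MeasurableSpace X] {mW : MeasurableSpace W}
    (P : Measure W) (ℱ : Filtration ℕ mW) (T : ℕ) (f : X → ℝ) (R : ℝ)
    (x : ℕ → W → X) (η y : ℕ → W → ℝ) : Prop where
  arm_measurable : ∀ t ∈ Finset.Icc 1 T, Measurable[ℱ t] (x t)
  reward_eq : ∀ t ∈ Finset.Icc 1 T, ∀ ω, y t ω = f (x t ω) + η t ω
  reward_measurable : ∀ t ∈ Finset.Icc 1 T, Measurable[ℱ (t + 1)] (y t)
  noise_integrable : ∀ t ∈ Finset.Icc 1 T, ∀ c : ℝ,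
    Integrable (fun ω => Real.exp (c * η t ω)) P
  noise_subGaussian : ∀ t ∈ Finset.Icc 1 T, ∀ c : ℝ,
    P[fun ω => Real.exp (c * η t ω) | ℱ t] ≤ᵐ[P] fun _ => Real.exp (c ^ 2 * R ^ 2 / 2)

/-- The regret `sup_{z ∈ A} ∑_{t=1}^T (f(z) - f(x_t))`. -/
def regret {X : Type*} (A : Set X) (f : X → ℝ) (T : ℕ) (x : ℕ → X) : ℝ :=
  ⨆ z : A, ∑ t ∈ Finset.Icc 1 T, (f z - f (x t))

/-! ### The bound -/

/-- `β_T^{IGP-UCB} = B + R √(2 (γ_T + 1 + log (1/δ)))`, as a function of `γ = γ_T`. -/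
def betaIGP (B R δ γ : ℝ) : ℝ :=
  B + R * √(2 * (γ + 1 + Real.log (1 / δ)))

/-- The function
`b(T) = 4 β_T^{IGP-UCB} √(γ_T T) + C (√(T γ_T) T^{(3/2-q)/2} + γ_T T^{1-q})`. -/
def regretBound (B R δ q C : ℝ) (γ : ℕ → ℝ) (T : ℕ) : ℝ :=
  4 * betaIGP B R δ (γ T) * √(γ T * T) +
    C * (√(T * γ T) * (T : ℝ) ^ ((3 / 2 - q) / 2) + γ T * (T : ℝ) ^ (1 - q))

end RKHSBandit

end

open RKHSBandit

/-!
The regret of APG-UCB is bounded by comparing a kernel bandit with a slightly misspecified linear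
bandit in `D` dimensions.

*Reduction to features.* In the RKHS, the Newton basis is the Gram–Schmidt orthonormalization of the
representers `K(·, ξ_m)` (`orthonormal_newtonVec`), and `powerSq K ξ D x` is the squared norm of the
component `newtonResidual` of `K(·, x)` orthogonal to it. Projecting `f` onto the basis gives a
vector `θ` with `‖θ‖ ≤ ‖f‖ ≤ B` and `|f x - ⟨x̃, θ⟩| ≤ B e` on the arms (`exists_coeff_abs_sub_le`).

*Confidence bound.* With probability at least `1 - δ`, the noise sums `S_t = ∑ η_s v_s` satisfy
`‖S_t‖_{A_t⁻¹} ≤ R √(log (det A_t / δ²))` for all `t ≤ T` simultaneously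
(`one_sub_le_measureReal_noiseSum_le`). After scaling to `R = 1`, the process
`(det A_t)^{-1/2} exp (‖S_t‖² / 2)` is a supermartingale, and Ville's inequality applies. Instead of
integrating exponential supermartingales over a `D`-dimensional Gaussian, the supermartingale
property is verified one step at a time: by the rank-one update formulas for determinant and
inverse, it reduces to a moment of `exp` of a quadratic polynomial in the scalar `η_{t+1}`, which a
one-dimensional Gaussian average turns into the sub-Gaussian condition
(`IsCondSubGaussianOne.lintegral_mul_exp_quadratic_le`). The misspecification adds at most `ε ψ_t`
to the radius, because `‖v_s‖_{A_t⁻¹} ≤ ‖v_s‖_{A_{s-1}⁻¹}` for `s ≤ t`.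

*Regret.* By optimism, the regret is at most `2 ψ_T (β_T + ε ψ_T) + 2 ε T` (`regret_le_psi_mul`).
The elliptical potential bound gives `ψ_T² ≤ 2 T log det A_T`. Moreover `log det A_T ≤ 2 γ_T`
(`log_det_gram_le_maxInfoGain`), because `det A_T = det (1 + V Vᵀ)` for the matrix `V` of features,
while the kernel matrix exceeds `V Vᵀ` by the positive semidefinite Gram matrix of the residuals.
With `ε = B α / T^q` the regret is at most `4 β √(γ_T T) + (8 B α γ_T + 2 B α) T^{1-q}`, and the
summand `2 B α` is absorbed because `γ_T` is bounded below by a positive constant.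

*Asymptotics.* Since `γ_T ≤ T / 2` and `β ≥ B`, the remainder divided by the leading term is
`O(T^{(3/2-q)/2} + T^{1-q})`.
-/

namespace RKHSBandit

/-! ### Rank-one updates of positive definite matrices -/

section RankOne

lemma posDef_add_vecMulVec {n : Type*} [Fintype n] {M : Matrix n n ℝ} (hM : M.PosDef) (v : n → ℝ) :
    (M + Matrix.vecMulVec v v).PosDef :=
  hM.add_posSemidef (by simpa using Matrix.posSemidef_vecMulVec_self_star v)

variable {n : Type*} [Fintype n] [DecidableEq n]

lemma dotProduct_inv_mulVec_comm {M : Matrix n n ℝ} (hM : M.PosDef) (w z : n → ℝ) :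
    w ⬝ᵥ M⁻¹.mulVec z = z ⬝ᵥ M⁻¹.mulVec w := by
  have h : M⁻¹.transpose = M⁻¹ := by
    simpa using hM.inv.isHermitian.eq
  rw [← Matrix.dotProduct_transpose_mulVec, h, dotProduct_comm]

lemma dotProduct_inv_mulVec_nonneg {M : Matrix n n ℝ} (hM : M.PosDef) (w : n → ℝ) :
    0 ≤ w ⬝ᵥ M⁻¹.mulVec w := by
  simpa using hM.inv.posSemidef.dotProduct_mulVec_nonneg w

/-- The matrix determinant lemma for a symmetric rank-one update. -/
lemma det_add_vecMulVec_self {M : Matrix n n ℝ} (hM : M.PosDef) (v : n → ℝ) :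
    (M + Matrix.vecMulVec v v).det = M.det * (1 + v ⬝ᵥ M⁻¹.mulVec v) := by
  rw [Matrix.vecMulVec_eq Unit, Matrix.det_add_replicateCol_mul_replicateRow hM.det_pos.ne'.isUnit]
  congr 1
  rw [Matrix.det_unique]
  simp [Matrix.mul_apply, dotProduct, Matrix.mulVec, Finset.mul_sum, Finset.sum_mul]
  rw [Finset.sum_comm]
  simp [mul_assoc]

/-- The Sherman–Morrison formula, for the bilinear form of the inverse matrix. -/
lemma dotProduct_inv_add_vecMulVec_self {M : Matrix n n ℝ} (hM : M.PosDef) (v w z : n → ℝ) :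
    w ⬝ᵥ (M + Matrix.vecMulVec v v)⁻¹.mulVec z =
      w ⬝ᵥ M⁻¹.mulVec z -
        (w ⬝ᵥ M⁻¹.mulVec v) * (v ⬝ᵥ M⁻¹.mulVec z) / (1 + v ⬝ᵥ M⁻¹.mulVec v) := by
  have hu : (1 + v ⬝ᵥ M⁻¹.mulVec v) ≠ 0 := by
    have := dotProduct_inv_mulVec_nonneg hM v
    positivity
  have hMu : IsUnit M.det := hM.det_pos.ne'.isUnit
  have hNu : IsUnit (M + Matrix.vecMulVec v v).det :=
    (posDef_add_vecMulVec hM v).det_pos.ne'.isUnit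
  -- solve `(M + v vᵀ) x = z` by `x = M⁻¹ z - c M⁻¹ v`
  set c := (v ⬝ᵥ M⁻¹.mulVec z) / (1 + v ⬝ᵥ M⁻¹.mulVec v) with hc
  have key : (M + Matrix.vecMulVec v v).mulVec (M⁻¹.mulVec z - c • M⁻¹.mulVec v) = z := by
    rw [Matrix.add_mulVec, Matrix.vecMulVec_mulVec, Matrix.mulVec_sub, Matrix.mulVec_smul,
      Matrix.mulVec_mulVec, Matrix.mulVec_mulVec, Matrix.mul_nonsing_inv _ hMu,
      Matrix.one_mulVec, Matrix.one_mulVec, dotProduct_sub, dotProduct_smul]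
    have : v ⬝ᵥ M⁻¹.mulVec z - c • (v ⬝ᵥ M⁻¹.mulVec v) = c := by
      rw [hc, smul_eq_mul]; field_simp; ring
    rw [this]
    ext i
    simp [mul_comm]
  have h2 : (M + Matrix.vecMulVec v v)⁻¹.mulVec z = M⁻¹.mulVec z - c • M⁻¹.mulVec v := by
    conv_lhs => rw [← key]
    rw [Matrix.mulVec_mulVec, Matrix.nonsing_inv_mul _ hNu, Matrix.one_mulVec]
  rw [h2, dotProduct_sub, dotProduct_smul, hc, smul_eq_mul]
  ring

lemma dotProduct_inv_add_vecMulVec_self_le {M : Matrix n n ℝ} (hM : M.PosDef) (v w : n → ℝ) :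
    w ⬝ᵥ (M + Matrix.vecMulVec v v)⁻¹.mulVec w ≤ w ⬝ᵥ M⁻¹.mulVec w := by
  rw [dotProduct_inv_add_vecMulVec_self hM, dotProduct_inv_mulVec_comm hM v w]
  have := dotProduct_inv_mulVec_nonneg hM v
  have : 0 ≤ (w ⬝ᵥ M⁻¹.mulVec v) * (w ⬝ᵥ M⁻¹.mulVec v) / (1 + v ⬝ᵥ M⁻¹.mulVec v) :=
    div_nonneg (mul_self_nonneg _) (by positivity)
  linarith

/-- The determinant is monotone in the Loewner order. -/
lemma det_le_det_add_posSemidef {M Q : Matrix n n ℝ} (hM : M.PosDef) (hQ : Q.PosSemidef) :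
    M.det ≤ (M + Q).det := by
  -- add the rank-one terms of `Q` one at a time; each multiplies the determinant by at least `1`
  obtain ⟨m, v, rfl⟩ := Matrix.posSemidef_iff_eq_sum_vecMulVec.mp hQ
  suffices h : ∀ s : Finset (Fin m), (M + ∑ i ∈ s, Matrix.vecMulVec (v i) (star (v i))).PosDef ∧
      M.det ≤ (M + ∑ i ∈ s, Matrix.vecMulVec (v i) (star (v i))).det from (h _).2
  intro s
  induction s using Finset.induction_on with
  | empty => simpa using hM
  | insert a s ha ih =>
    rw [Finset.sum_insert ha, add_comm (Matrix.vecMulVec _ _), ← add_assoc, star_trivial]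
    refine ⟨posDef_add_vecMulVec ih.1 _, ?_⟩
    rw [det_add_vecMulVec_self ih.1]
    have h1 := dotProduct_inv_mulVec_nonneg ih.1 (v a)
    have h2 := ih.1.det_pos
    nlinarith [ih.2, mul_nonneg h2.le h1]

/-- `log det M ≤ tr M - n`, by `log s ≤ s - 1` for each eigenvalue. -/
lemma log_det_le_trace_sub_card {M : Matrix n n ℝ} (hM : M.PosDef) :
    Real.log M.det ≤ M.trace - Fintype.card n := by
  rw [hM.isHermitian.det_eq_prod_eigenvalues, hM.isHermitian.trace_eq_sum_eigenvalues]
  simp only [RCLike.ofReal_real_eq_id, id]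
  rw [Real.log_prod fun i _ => (hM.eigenvalues_pos i).ne']
  calc _ ≤ ∑ i, (hM.isHermitian.eigenvalues i - 1) :=
        Finset.sum_le_sum fun i _ => Real.log_le_sub_one_of_pos (hM.eigenvalues_pos i)
    _ = _ := by simp

lemma mahalanobis_nonneg {D : ℕ} (M : Matrix (Fin D) (Fin D) ℝ) (w : Fin D → ℝ) :
    0 ≤ mahalanobis M w := Real.sqrt_nonneg _

/-- The Cauchy–Schwarz inequality for the inner product of `M⁻¹`. -/
lemma abs_dotProduct_inv_mulVec_le {D : ℕ} {M : Matrix (Fin D) (Fin D) ℝ} (hM : M.PosDef)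
    (w z : Fin D → ℝ) :
    |w ⬝ᵥ M⁻¹.mulVec z| ≤ mahalanobis M⁻¹ w * mahalanobis M⁻¹ z := by
  rw [mahalanobis, mahalanobis, ← Real.sqrt_mul (dotProduct_inv_mulVec_nonneg hM w)]
  refine Real.abs_le_sqrt ?_
  -- discriminant of the nonnegative quadratic polynomial `t ↦ ‖w + t z‖²`
  have h : ∀ t : ℝ, 0 ≤ (z ⬝ᵥ M⁻¹.mulVec z) * (t * t) + (2 * (w ⬝ᵥ M⁻¹.mulVec z)) * t
      + w ⬝ᵥ M⁻¹.mulVec w := by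
    intro t
    have := dotProduct_inv_mulVec_nonneg hM (w + t • z)
    simp only [Matrix.mulVec_add, Matrix.mulVec_smul, add_dotProduct, dotProduct_add,
      smul_dotProduct, dotProduct_smul, smul_eq_mul, dotProduct_inv_mulVec_comm hM z w] at this
    linarith
  have := discrim_le_zero h
  rw [discrim] at this
  linarith

end RankOne

/-! ### The Gram matrices and the elliptical potential -/

section Gram

variable {D : ℕ} (v : ℕ → Fin D → ℝ)

@[simp] lemma gram_one_zero : gram 1 v 0 = 1 := by simp [gram]

lemma gram_succ (lam : ℝ) (t : ℕ) :
    gram lam v (t + 1) = gram lam v t + Matrix.vecMulVec (v (t + 1)) (v (t + 1)) := by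
  rw [gram, gram, Finset.sum_Icc_succ_top (by omega), add_assoc]

lemma posDef_gram_one (t : ℕ) : (gram 1 v t).PosDef := by
  induction t with
  | zero => simpa using Matrix.PosDef.one
  | succ t ih => rw [gram_succ]; exact posDef_add_vecMulVec ih _

lemma mahalanobis_inv_gram_succ_le (t : ℕ) (w : Fin D → ℝ) :
    mahalanobis (gram 1 v (t + 1))⁻¹ w ≤ mahalanobis (gram 1 v t)⁻¹ w := by
  rw [gram_succ]
  exact Real.sqrt_le_sqrt (dotProduct_inv_add_vecMulVec_self_le (posDef_gram_one v t) _ _)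

lemma mahalanobis_inv_gram_antitone (w : Fin D → ℝ) :
    Antitone fun t => mahalanobis (gram 1 v t)⁻¹ w :=
  antitone_nat_of_succ_le fun t => mahalanobis_inv_gram_succ_le v t w

lemma mahalanobis_inv_gram_sq (t : ℕ) (w : Fin D → ℝ) :
    mahalanobis (gram 1 v t)⁻¹ w ^ 2 = w ⬝ᵥ (gram 1 v t)⁻¹.mulVec w :=
  Real.sq_sqrt (dotProduct_inv_mulVec_nonneg (posDef_gram_one v t) w)

lemma det_gram_succ (t : ℕ) : (gram 1 v (t + 1)).det =
    (gram 1 v t).det * (1 + mahalanobis (gram 1 v t)⁻¹ (v (t + 1)) ^ 2) := by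
  rw [gram_succ, det_add_vecMulVec_self (posDef_gram_one v t), mahalanobis_inv_gram_sq]

lemma one_le_det_gram (t : ℕ) : 1 ≤ (gram 1 v t).det := by
  induction t with
  | zero => simp
  | succ t ih =>
    rw [det_gram_succ]
    nlinarith [sq_nonneg (mahalanobis (gram 1 v t)⁻¹ (v (t + 1)))]

lemma det_gram_mono : Monotone fun t => (gram 1 v t).det :=
  monotone_nat_of_le_succ fun t => by
    rw [det_gram_succ]
    nlinarith [sq_nonneg (mahalanobis (gram 1 v t)⁻¹ (v (t + 1))), one_le_det_gram v t]

/-- Since `A_t ≥ 1`, the norm of `A_t⁻¹` is at most the Euclidean norm. -/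
lemma mahalanobis_inv_gram_sq_le (t : ℕ) (w : Fin D → ℝ) :
    mahalanobis (gram 1 v t)⁻¹ w ^ 2 ≤ w ⬝ᵥ w := by
  have h := pow_le_pow_left₀ (mahalanobis_nonneg _ _)
    (mahalanobis_inv_gram_antitone v w (Nat.zero_le t)) 2
  refine h.trans ?_
  rw [mahalanobis_inv_gram_sq]
  simp

lemma psi_succ (t : ℕ) :
    psi 1 v (t + 1) = psi 1 v t + mahalanobis (gram 1 v t)⁻¹ (v (t + 1)) := by
  rw [psi, psi, Finset.sum_Icc_succ_top (by omega)]
  simp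

lemma psi_mono : Monotone (psi 1 v) :=
  monotone_nat_of_le_succ fun t => by
    rw [psi_succ]; linarith [mahalanobis_nonneg (gram 1 v t)⁻¹ (v (t + 1))]

lemma psi_nonneg (t : ℕ) : 0 ≤ psi 1 v t :=
  Finset.sum_nonneg fun _ _ => mahalanobis_nonneg _ _

/-- The elliptical potential bound. -/
lemma sum_mahalanobis_sq_le (T : ℕ) (hv : ∀ t < T, v (t + 1) ⬝ᵥ v (t + 1) ≤ 1) :
    ∑ s ∈ Finset.Icc 1 T, mahalanobis (gram 1 v (s - 1))⁻¹ (v s) ^ 2 ≤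
      2 * Real.log (gram 1 v T).det := by
  induction T with
  | zero => simp
  | succ T ih =>
    have ih := ih fun t ht => hv t (by omega)
    rw [Finset.sum_Icc_succ_top (by omega), det_gram_succ, Nat.add_sub_cancel]
    set u := mahalanobis (gram 1 v T)⁻¹ (v (T + 1)) ^ 2 with hu
    have hu0 : 0 ≤ u := sq_nonneg _
    have hu1 : u ≤ 1 := (mahalanobis_inv_gram_sq_le v T _).trans (hv T (by omega))
    rw [Real.log_mul (zero_lt_one.trans_le (one_le_det_gram v T)).ne' (by positivity)]
    -- `log (1 + u) ≥ 1 - 1 / (1 + u) ≥ u / 2` for `0 ≤ u ≤ 1`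
    have h1 := Real.one_sub_inv_le_log_of_pos (show 0 < 1 + u by positivity)
    have h2 : u / 2 ≤ 1 - (1 + u)⁻¹ := by
      rw [← sub_nonneg]
      have : 1 - (1 + u)⁻¹ - u / 2 = u * (1 - u) / (2 * (1 + u)) := by field_simp; ring
      rw [this]
      exact div_nonneg (mul_nonneg hu0 (by linarith)) (by positivity)
    linarith

lemma psi_sq_le (T : ℕ) (hv : ∀ t < T, v (t + 1) ⬝ᵥ v (t + 1) ≤ 1) :
    psi 1 v T ^ 2 ≤ T * (2 * Real.log (gram 1 v T).det) := by
  have h := sq_sum_le_card_mul_sum_sq (s := Finset.Icc 1 T)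
    (f := fun s => mahalanobis (gram 1 v (s - 1))⁻¹ (v s))
  rw [Nat.card_Icc, Nat.add_sub_cancel] at h
  exact h.trans (mul_le_mul_of_nonneg_left (sum_mahalanobis_sq_le v T hv) (Nat.cast_nonneg T))

lemma beta_mono {R B δ : ℝ} (hR : 0 ≤ R) (hδ : 0 < δ) : Monotone (beta 1 R B δ v) := by
  intro s t hst
  simp only [beta, inv_one, one_smul]
  have h1 := det_gram_mono v hst
  have h2 := one_le_det_gram v s
  gcongr

end Gram

/-! ### Gaussian exponential moments -/

section Gaussian

open ProbabilityTheory Real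

lemma lintegral_exp_neg_mul_sq_add {p : ℝ} (hp : 0 < p) (b : ℝ) :
    ∫⁻ x : ℝ, ENNReal.ofReal (exp (-p * x ^ 2 + b * x)) =
      ENNReal.ofReal (√(π / p) * exp (b ^ 2 / (4 * p))) := by
  have h : ∀ x : ℝ, exp (-p * x ^ 2 + b * x) =
      exp (-p * (x + -(b / (2 * p))) ^ 2) * exp (b ^ 2 / (4 * p)) := by
    intro x
    rw [← exp_add]
    congr 1
    field_simp
    ring
  simp_rw [h]
  rw [← ofReal_integral_eq_lintegral_ofReal, integral_mul_const,
    integral_add_right_eq_self (fun x : ℝ => exp (-p * x ^ 2)), integral_gaussian]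
  · exact ((integrable_exp_neg_mul_sq hp).comp_add_right _).mul_const _
  · exact ae_of_all _ fun x => by positivity

/-- The exponential moments of quadratic polynomials in a standard Gaussian variable. -/
lemma lintegral_gaussianReal_exp_quadratic {a : ℝ} (ha : a < 1) (b d : ℝ) :
    ∫⁻ z, ENNReal.ofReal (exp (a * z ^ 2 / 2 + b * z + d)) ∂(gaussianReal 0 1) =
      ENNReal.ofReal (√(1 / (1 - a)) * exp (b ^ 2 / (2 * (1 - a)) + d)) := by
  have h1a : 0 < 1 - a := by linarith
  rw [gaussianReal_of_var_ne_zero _ one_ne_zero,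
    lintegral_withDensity_eq_lintegral_mul _ (measurable_gaussianPDF _ _) (by fun_prop)]
  have h : ∀ z : ℝ, (gaussianPDF 0 1 * fun z => ENNReal.ofReal (exp (a * z ^ 2 / 2 + b * z + d))) z
      = ENNReal.ofReal ((√(2 * π))⁻¹ * exp d) *
        ENNReal.ofReal (exp (-((1 - a) / 2) * z ^ 2 + b * z)) := by
    intro z
    rw [Pi.mul_apply, gaussianPDF, ← ENNReal.ofReal_mul (gaussianPDFReal_nonneg _ _ _),
      ← ENNReal.ofReal_mul (by positivity), gaussianPDFReal]
    simp only [NNReal.coe_one, mul_one, sub_zero]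
    rw [mul_assoc, mul_assoc, ← exp_add, ← exp_add]
    congr 3
    ring
  simp_rw [h]
  rw [lintegral_const_mul _ (by fun_prop), lintegral_exp_neg_mul_sq_add (by positivity),
    ← ENNReal.ofReal_mul (by positivity)]
  congr 1
  have h2 : √(π / ((1 - a) / 2)) = √(2 * π) * √(1 / (1 - a)) := by
    rw [← sqrt_mul (by positivity)]
    congr 1
    field_simp
  have h3 : b ^ 2 / (4 * ((1 - a) / 2)) = b ^ 2 / (2 * (1 - a)) := by
    congr 1; ring
  rw [h2, h3, exp_add]
  have : √(2 * π) ≠ 0 := by positivity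
  field_simp

end Gaussian

/-! ### Conditionally sub-Gaussian noise -/

section SubGaussian

open ProbabilityTheory Real

/-- The conditional sub-Gaussian condition with variance proxy `1`: the conditional moment
generating function of `η` given the σ-algebra `m` is at most `exp (c² / 2)` at every `c`. -/
structure IsCondSubGaussianOne {W : Type*} (m : MeasurableSpace W) {mW : MeasurableSpace W}
    (P : Measure W) (η : W → ℝ) : Prop where
  integrable : ∀ c : ℝ, Integrable (fun ω => exp (c * η ω)) P
  condExp_le : ∀ c : ℝ, P[fun ω => exp (c * η ω) | m] ≤ᵐ[P] fun _ => exp (c ^ 2 / 2)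

namespace IsCondSubGaussianOne

variable {W : Type*} {m mW : MeasurableSpace W} {P : Measure W} [IsProbabilityMeasure P]
  {η : W → ℝ}

lemma setLIntegral_exp_le (hη : IsCondSubGaussianOne m P η) (hm : m ≤ mW) (c : ℝ) {s : Set W}
    (hs : MeasurableSet[m] s) :
    ∫⁻ ω in s, ENNReal.ofReal (exp (c * η ω)) ∂P ≤ ENNReal.ofReal (exp (c ^ 2 / 2)) * P s := by
  rw [← ofReal_integral_eq_lintegral_ofReal (hη.integrable c).integrableOn
    (ae_of_all _ fun ω => (exp_pos _).le), ← setIntegral_condExp hm (hη.integrable c) hs]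
  calc _ ≤ ENNReal.ofReal (∫ _ in s, exp (c ^ 2 / 2) ∂P) := by
        refine ENNReal.ofReal_le_ofReal (setIntegral_mono_ae integrable_condExp.integrableOn
          (integrable_const _).integrableOn (hη.condExp_le c))
    _ = _ := by
        rw [setIntegral_const, smul_eq_mul, mul_comm, ENNReal.ofReal_mul (exp_pos _).le,
          Measure.real, ENNReal.ofReal_toReal (measure_ne_top _ _)]

lemma lintegral_mul_exp_const_le (hη : IsCondSubGaussianOne m P η) (hm : m ≤ mW)
    (hη_meas : Measurable η) (c : ℝ) {h : W → ENNReal} (hh : Measurable[m] h) :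
    ∫⁻ ω, h ω * ENNReal.ofReal (exp (c * η ω)) ∂P ≤
      ∫⁻ ω, h ω * ENNReal.ofReal (exp (c ^ 2 / 2)) ∂P := by
  -- compare the measure with density `exp (c η)` to a multiple of `P`, on the σ-algebra `m`
  have hg : Measurable fun ω => ENNReal.ofReal (exp (c * η ω)) := by fun_prop
  have key : (P.withDensity fun ω => ENNReal.ofReal (exp (c * η ω))).trim hm ≤
      (ENNReal.ofReal (exp (c ^ 2 / 2)) • P).trim hm := by
    rw [Measure.le_iff]
    intro s hs
    rw [trim_measurableSet_eq hm hs, trim_measurableSet_eq hm hs,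
      withDensity_apply _ (hm s hs)]
    simpa using hη.setLIntegral_exp_le hm c hs
  calc ∫⁻ ω, h ω * ENNReal.ofReal (exp (c * η ω)) ∂P
      = ∫⁻ ω, h ω ∂(P.withDensity fun ω => ENNReal.ofReal (exp (c * η ω))) := by
        rw [lintegral_withDensity_eq_lintegral_mul _ hg (hh.mono hm le_rfl)]
        simp [mul_comm]
    _ = ∫⁻ ω, h ω ∂((P.withDensity fun ω => ENNReal.ofReal (exp (c * η ω))).trim hm) :=
        (lintegral_trim hm hh).symm
    _ ≤ ∫⁻ ω, h ω ∂((ENNReal.ofReal (exp (c ^ 2 / 2)) • P).trim hm) :=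
        lintegral_mono' key le_rfl
    _ = _ := by
        rw [lintegral_trim hm hh, lintegral_smul_measure,
          lintegral_mul_const _ (hh.mono hm le_rfl), mul_comm, smul_eq_mul, mul_comm]

/-- The sub-Gaussian condition at a countably-valued `m`-measurable argument. -/
lemma lintegral_mul_exp_countable_le (hη : IsCondSubGaussianOne m P η) (hm : m ≤ mW)
    (hη_meas : Measurable η) {k : W → ℤ} (hk : Measurable[m] k) (g : ℤ → ℝ)
    {h : W → ENNReal} (hh : Measurable[m] h) :
    ∫⁻ ω, h ω * ENNReal.ofReal (exp (g (k ω) * η ω)) ∂P ≤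
      ∫⁻ ω, h ω * ENNReal.ofReal (exp (g (k ω) ^ 2 / 2)) ∂P := by
  have hs : ∀ j, MeasurableSet[m] {ω | k ω = j} := fun j => hk (measurableSet_singleton j)
  have hi : ∀ j, Measurable[m] (Set.indicator {ω | k ω = j} h) := fun j => hh.indicator (hs j)
  have split : ∀ F : ℤ → W → ENNReal, (∀ j, Measurable (F j)) →
      ∫⁻ ω, h ω * F (k ω) ω ∂P =
        ∑' j, ∫⁻ ω, Set.indicator {ω | k ω = j} h ω * F j ω ∂P := by
    intro F hF
    refine .trans (lintegral_congr fun ω => ?_) (lintegral_tsum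
      fun j => (((hi j).mono hm le_rfl).mul (hF j)).aemeasurable)
    rw [tsum_eq_single (k ω)]
    · simp
    · intro j hj
      simp [Ne.symm hj]
  rw [split (fun j ω => ENNReal.ofReal (exp (g j * η ω))) fun j => by fun_prop,
    split (fun j _ => ENNReal.ofReal (exp (g j ^ 2 / 2))) fun j => by fun_prop]
  exact ENNReal.tsum_le_tsum fun j => hη.lintegral_mul_exp_const_le hm hη_meas (g j) (hi j)

/-- The sub-Gaussian condition extends from constants to `m`-measurable arguments `ξ`: round `ξ`
towards zero to multiples of `1 / (N + 1)`, which does not increase `ξ²`, and apply Fatou's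
lemma. -/
lemma lintegral_mul_exp_le (hη : IsCondSubGaussianOne m P η) (hm : m ≤ mW)
    (hη_meas : Measurable η) {ξ : W → ℝ} (hξ : Measurable[m] ξ)
    {h : W → ENNReal} (hh : Measurable[m] h) :
    ∫⁻ ω, h ω * ENNReal.ofReal (exp (ξ ω * η ω)) ∂P ≤
      ∫⁻ ω, h ω * ENNReal.ofReal (exp (ξ ω ^ 2 / 2)) ∂P := by
  have hh' := hh.mono hm le_rfl
  set k : ℕ → W → ℤ := fun N ω => if 0 ≤ ξ ω then ⌊(N + 1) * ξ ω⌋ else ⌈(N + 1) * ξ ω⌉ with hk_def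
  have hk : ∀ N, Measurable[m] (k N) := fun N =>
    Measurable.ite (measurableSet_le measurable_const hξ)
      (Int.measurable_floor.comp (hξ.const_mul _)) (Int.measurable_ceil.comp (hξ.const_mul _))
  set g : ℕ → ℤ → ℝ := fun N j => j / (N + 1) with hg
  have hpos : ∀ N : ℕ, (0 : ℝ) < N + 1 := fun N => by positivity
  have hsq : ∀ N ω, g N (k N ω) ^ 2 ≤ ξ ω ^ 2 := by
    intro N ω
    have hp := hpos N
    simp only [hg, hk_def]
    rw [sq_le_sq]
    split_ifs with h0
    · have h1 : (0 : ℝ) ≤ ⌊(N + 1) * ξ ω⌋ := by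
        exact_mod_cast Int.floor_nonneg.mpr (by positivity)
      rw [abs_of_nonneg (by positivity), abs_of_nonneg h0, div_le_iff₀ hp, mul_comm]
      exact Int.floor_le _
    · push Not at h0
      have h1 : ((⌈(N + 1) * ξ ω⌉ : ℤ) : ℝ) ≤ 0 := by
        exact_mod_cast Int.ceil_le.mpr (by push_cast; nlinarith)
      rw [abs_of_nonpos (div_nonpos_of_nonpos_of_nonneg h1 hp.le), abs_of_neg h0, neg_le_neg_iff,
        le_div_iff₀ hp, mul_comm]
      exact Int.le_ceil _
  have hdist : ∀ N ω, |g N (k N ω) - ξ ω| ≤ 1 / ((N : ℝ) + 1) := by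
    intro N ω
    have hp := hpos N
    have : g N (k N ω) - ξ ω = (k N ω - (N + 1) * ξ ω) / (N + 1) := by
      simp only [hg]; field_simp
    rw [this, abs_div, abs_of_pos hp]
    refine div_le_div_of_nonneg_right ?_ hp.le
    simp only [hk_def]
    rw [abs_le]
    split_ifs
    · have h1 := Int.floor_le ((N + 1) * ξ ω)
      have h2 := Int.lt_floor_add_one ((N + 1) * ξ ω)
      constructor <;> linarith
    · have h1 := Int.le_ceil ((N + 1) * ξ ω)
      have h2 := Int.ceil_lt_add_one ((N + 1) * ξ ω)
      constructor <;> linarith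
  have hlim : ∀ ω, Tendsto (fun N => g N (k N ω)) atTop (nhds (ξ ω)) := fun ω => by
    rw [tendsto_iff_norm_sub_tendsto_zero]
    exact squeeze_zero (fun N => norm_nonneg _) (fun N => hdist N ω)
      tendsto_one_div_add_atTop_nhds_zero_nat
  have hgk : ∀ N, Measurable fun ω => g N (k N ω) := fun N =>
    (measurable_of_countable (g N)).comp ((hk N).mono hm le_rfl)
  calc ∫⁻ ω, h ω * ENNReal.ofReal (exp (ξ ω * η ω)) ∂P
      = ∫⁻ ω, liminf (fun N => h ω * ENNReal.ofReal (exp (g N (k N ω) * η ω))) atTop ∂P := by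
        refine lintegral_congr fun ω => (Tendsto.liminf_eq ?_).symm
        refine ENNReal.Tendsto.const_mul (ENNReal.tendsto_ofReal ?_) (Or.inl ?_)
        · exact (continuous_exp.tendsto _).comp ((hlim ω).mul_const _)
        · simp [exp_pos]
    _ ≤ liminf (fun N => ∫⁻ ω, h ω * ENNReal.ofReal (exp (g N (k N ω) * η ω)) ∂P) atTop :=
        lintegral_liminf_le fun N =>
          hh'.mul ((hgk N).mul hη_meas).exp.ennreal_ofReal
    _ ≤ liminf (fun _ : ℕ => ∫⁻ ω, h ω * ENNReal.ofReal (exp (ξ ω ^ 2 / 2)) ∂P) atTop := by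
        refine liminf_le_liminf (Eventually.of_forall fun N => ?_)
        refine (hη.lintegral_mul_exp_countable_le hm hη_meas (hk N) (g N) hh).trans ?_
        refine lintegral_mono fun ω => ?_
        have := hsq N ω
        gcongr
    _ = _ := by simp

/-- The one-dimensional mixture bound. Both sides are averages over a standard Gaussian `z`: the
integrand on the left is proportional to the average of `exp (ξ η)` with
`ξ = c / (1 + u) + √(u / (1 + u)) z`, and averaging `exp (ξ² / 2)` gives the right-hand side. -/
lemma lintegral_mul_exp_quadratic_le (hη : IsCondSubGaussianOne m P η) (hm : m ≤ mW)
    (hη_meas : Measurable η) {c u : W → ℝ} (hc : Measurable[m] c) (hu : Measurable[m] u)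
    (hu0 : ∀ ω, 0 ≤ u ω) {h : W → ENNReal} (hh : Measurable[m] h) :
    ∫⁻ ω, h ω * ENNReal.ofReal
        (exp ((2 * η ω * c ω + η ω ^ 2 * u ω - c ω ^ 2) / (2 * (1 + u ω)))) ∂P ≤
      ∫⁻ ω, h ω * ENNReal.ofReal √(1 + u ω) ∂P := by
  set w : W → ENNReal := fun ω => h ω * ENNReal.ofReal (exp (-(c ω ^ 2 / (2 * (1 + u ω))))) with hw
  set ξ : ℝ → W → ℝ := fun z ω => c ω / (1 + u ω) + √(u ω / (1 + u ω)) * z with hξ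
  have hwm : Measurable[m] w := by rw [hw]; fun_prop
  have hξm : ∀ z, Measurable[m] (ξ z) := fun z => by simp only [hξ]; fun_prop
  have hw' : Measurable w := hwm.mono hm le_rfl
  have hc' := hc.mono hm le_rfl
  have hu' := hu.mono hm le_rfl
  have hs : ∀ ω, √(u ω / (1 + u ω)) ^ 2 = u ω / (1 + u ω) := fun ω =>
    sq_sqrt (div_nonneg (hu0 ω) (by linarith [hu0 ω]))
  have h1 : ∀ ω, h ω * ENNReal.ofReal
      (exp ((2 * η ω * c ω + η ω ^ 2 * u ω - c ω ^ 2) / (2 * (1 + u ω)))) =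
      ∫⁻ z, w ω * ENNReal.ofReal (exp (ξ z ω * η ω)) ∂(gaussianReal 0 1) := by
    intro ω
    have hp : 1 + u ω ≠ 0 := by linarith [hu0 ω]
    have e : ∀ z, ξ z ω * η ω = 0 * z ^ 2 / 2 + (√(u ω / (1 + u ω)) * η ω) * z
        + c ω / (1 + u ω) * η ω := fun z => by simp only [hξ]; ring
    simp_rw [e]
    rw [lintegral_const_mul _ (by fun_prop), lintegral_gaussianReal_exp_quadratic zero_lt_one,
      hw]
    dsimp only
    rw [mul_assoc (h ω), ← ENNReal.ofReal_mul (exp_pos _).le]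
    congr 2
    rw [sub_zero, div_one, sqrt_one, one_mul, ← exp_add, mul_pow, hs]
    congr 1
    field_simp
    ring
  have h2 : ∀ ω, h ω * ENNReal.ofReal √(1 + u ω) =
      ∫⁻ z, w ω * ENNReal.ofReal (exp (ξ z ω ^ 2 / 2)) ∂(gaussianReal 0 1) := by
    intro ω
    have hp : 0 < 1 + u ω := by linarith [hu0 ω]
    have e : ∀ z, ξ z ω ^ 2 / 2 = (u ω / (1 + u ω)) * z ^ 2 / 2
        + (√(u ω / (1 + u ω)) * (c ω / (1 + u ω))) * z + (c ω / (1 + u ω)) ^ 2 / 2 := fun z => by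
      simp only [hξ]; linear_combination (z ^ 2 / 2) * hs ω
    simp_rw [e]
    have h1a : 1 - u ω / (1 + u ω) = 1 / (1 + u ω) := by field_simp; ring
    rw [lintegral_const_mul _ (by fun_prop), lintegral_gaussianReal_exp_quadratic
      ((div_lt_one hp).mpr (by linarith)), hw]
    dsimp only
    rw [mul_assoc (h ω), ← ENNReal.ofReal_mul (exp_pos _).le, h1a, one_div_one_div, mul_left_comm, ← exp_add, mul_pow, hs]
    have : -(c ω ^ 2 / (2 * (1 + u ω))) + (u ω / (1 + u ω) * (c ω / (1 + u ω)) ^ 2 /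
        (2 * (1 / (1 + u ω))) + (c ω / (1 + u ω)) ^ 2 / 2) = 0 := by
      field_simp; ring
    rw [this, exp_zero, mul_one]
  simp_rw [h1, h2]
  calc _ = ∫⁻ z, ∫⁻ ω, w ω * ENNReal.ofReal (exp (ξ z ω * η ω)) ∂P ∂(gaussianReal 0 1) :=
        lintegral_lintegral_swap (by fun_prop)
    _ ≤ ∫⁻ z, ∫⁻ ω, w ω * ENNReal.ofReal (exp (ξ z ω ^ 2 / 2)) ∂P ∂(gaussianReal 0 1) :=
        lintegral_mono fun z => hη.lintegral_mul_exp_le hm hη_meas (hξm z) hwm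
    _ = _ := (lintegral_lintegral_swap (by fun_prop)).symm

end IsCondSubGaussianOne

end SubGaussian

/-! ### Ville's maximal inequality -/

section Ville

variable {W : Type*} {mW : MeasurableSpace W}

/-- Ville's maximal inequality, over finitely many rounds, for a nonnegative supermartingale; the
supermartingale property is stated through integrals over measurable sets of the past. -/
lemma mul_measure_exists_lt_le (P : Measure W) (𝒢 : Filtration ℕ mW) (T : ℕ)
    (Z : ℕ → W → ENNReal) (hZ : ∀ t ≤ T, Measurable[𝒢 t] (Z t))
    (hsup : ∀ t < T, ∀ s, MeasurableSet[𝒢 t] s → ∫⁻ ω in s, Z (t + 1) ω ∂P ≤ ∫⁻ ω in s, Z t ω ∂P)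
    (a : ENNReal) :
    a * P {ω | ∃ t ≤ T, a < Z t ω} ≤ ∫⁻ ω, Z 0 ω ∂P := by
  set E : ℕ → Set W := fun n => {ω | ∃ t ≤ n, a < Z t ω} with hE
  have hlt : ∀ t ≤ T, MeasurableSet[𝒢 t] {ω | a < Z t ω} := fun t ht =>
    measurableSet_lt measurable_const (hZ t ht)
  have hEm : ∀ n ≤ T, MeasurableSet[𝒢 n] (E n) := fun n hn => by
    have : E n = ⋃ t ∈ Finset.Iic n, {ω | a < Z t ω} := by ext ω; simp [hE]
    rw [this]
    exact Finset.measurableSet_biUnion _ fun t ht =>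
      𝒢.mono (Finset.mem_Iic.mp ht) _ (hlt t ((Finset.mem_Iic.mp ht).trans hn))
  have markov : ∀ t ≤ T, ∀ s ⊆ {ω | a < Z t ω}, MeasurableSet s →
      a * P s ≤ ∫⁻ ω in s, Z t ω ∂P := fun t ht s hs hsm => by
    rw [← setLIntegral_const]
    exact setLIntegral_mono' hsm fun ω hω => (hs hω).le
  -- the mass lost on the crossing event is paid for by the values of `Z` at the crossing time
  suffices key : ∀ n ≤ T, a * P (E n) + ∫⁻ ω in (E n)ᶜ, Z n ω ∂P ≤ ∫⁻ ω, Z 0 ω ∂P from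
    le_self_add.trans (key T le_rfl)
  intro n hn
  induction n with
  | zero =>
    have h0 := 𝒢.le 0 _ (hEm 0 hn)
    exact (add_le_add_left (markov 0 hn _ (fun ω => by simp [hE]) h0) _).trans_eq
      (lintegral_add_compl (Z 0) h0)
  | succ n ih =>
    have hn' : n ≤ T := by omega
    have hm := 𝒢.le n _ (hEm n hn')
    have hm1 := 𝒢.le (n + 1) _ (hlt (n + 1) hn)
    refine le_trans ?_ (ih hn')
    refine le_trans ?_ (add_le_add_right (hsup n (by omega) _ (hEm n hn').compl) _)
    rw [← lintegral_inter_add_sdiff (Z (n + 1)) (E n)ᶜ hm1, ← add_assoc]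
    have hE1 : E (n + 1) = E n ∪ (E n)ᶜ ∩ {ω | a < Z (n + 1) ω} := by
      ext ω
      simp only [hE, Set.mem_ofPred_eq, Set.mem_union, Set.mem_inter_iff, Set.mem_compl_iff]
      constructor
      · rintro ⟨t, ht, h⟩
        by_cases hx : ∃ t ≤ n, a < Z t ω
        · exact Or.inl hx
        · rcases Nat.le_succ_iff.mp ht with h' | h'
          · exact absurd ⟨t, h', h⟩ hx
          · subst h'; exact Or.inr ⟨hx, h⟩
      · rintro (⟨t, ht, h⟩ | ⟨-, h⟩)
        · exact ⟨t, by omega, h⟩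
        · exact ⟨n + 1, le_rfl, h⟩
    have hE2 : (E (n + 1))ᶜ = (E n)ᶜ \ {ω | a < Z (n + 1) ω} := by
      rw [hE1]; ext ω; simp; tauto
    rw [hE2]
    gcongr
    calc a * P (E (n + 1)) ≤ a * (P (E n) + P ((E n)ᶜ ∩ {ω | a < Z (n + 1) ω})) := by
          rw [hE1]; gcongr; exact measure_union_le _ _
      _ ≤ _ := by
          rw [mul_add]
          gcongr
          exact markov (n + 1) hn _ Set.inter_subset_right (hm.compl.inter hm1)

end Ville

/-! ### Measurability of determinants and inverses -/

section Measurability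

variable {W n : Type*} [MeasurableSpace W] [Fintype n] [DecidableEq n]

lemma measurable_matrix_det {M : W → Matrix n n ℝ} (hM : ∀ i j, Measurable fun ω => M ω i j) :
    Measurable fun ω => (M ω).det := by
  simp_rw [Matrix.det_apply]
  fun_prop

lemma measurable_matrix_inv_apply {M : W → Matrix n n ℝ}
    (hM : ∀ i j, Measurable fun ω => M ω i j) (i j : n) :
    Measurable fun ω => (M ω)⁻¹ i j := by
  simp_rw [Matrix.inv_def, Ring.inverse_eq_inv', Matrix.smul_apply, Matrix.adjugate_apply,
    smul_eq_mul]
  refine (measurable_matrix_det hM).inv.mul (measurable_matrix_det fun k l => ?_)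
  by_cases h : k = j
  · subst h; simp [Matrix.updateRow_self]
  · simpa [Matrix.updateRow_ne h] using hM k l

lemma measurable_dotProduct_inv_mulVec {M : W → Matrix n n ℝ}
    (hM : ∀ i j, Measurable fun ω => M ω i j) {w z : W → n → ℝ} (hw : Measurable w)
    (hz : Measurable z) : Measurable fun ω => w ω ⬝ᵥ (M ω)⁻¹.mulVec (z ω) := by
  have := measurable_matrix_inv_apply hM
  exact Finset.measurable_sum _ fun i _ => ((measurable_pi_apply i).comp hw).mul
    (Finset.measurable_sum _ fun j _ => (this i j).mul ((measurable_pi_apply j).comp hz))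

end Measurability

/-! ### The self-normalized tail bound -/

section SelfNormalized

open Real

variable {D : ℕ}

/-- The noise part `∑_{s=1}^t η_s v_s` of the regression targets. -/
noncomputable def noiseSum (v : ℕ → Fin D → ℝ) (η : ℕ → ℝ) (t : ℕ) : Fin D → ℝ :=
  ∑ s ∈ Finset.Icc 1 t, η s • v s

lemma noiseSum_succ (v : ℕ → Fin D → ℝ) (η : ℕ → ℝ) (t : ℕ) :
    noiseSum v η (t + 1) = noiseSum v η t + η (t + 1) • v (t + 1) := by
  rw [noiseSum, noiseSum, Finset.sum_Icc_succ_top (by omega)]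

/-- The mixture process `(det A_t)^{-1/2} exp (‖S_t‖² / 2)`, with `S_t` the noise sum and the norm
that of `A_t⁻¹`. It is the Gaussian average of the exponential supermartingales
`exp (⟨θ, S_t⟩ - θᵀ (A_t - 1) θ / 2)` over `θ`. -/
noncomputable def mixture (v : ℕ → Fin D → ℝ) (η : ℕ → ℝ) (t : ℕ) : ℝ :=
  (√(gram 1 v t).det)⁻¹ *
    exp ((noiseSum v η t ⬝ᵥ (gram 1 v t)⁻¹.mulVec (noiseSum v η t)) / 2)

lemma mixture_nonneg (v : ℕ → Fin D → ℝ) (η : ℕ → ℝ) (t : ℕ) : 0 ≤ mixture v η t := by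
  unfold mixture; positivity

/-- One step of the mixture process: the factor is the integrand of the one-dimensional mixture
bound, by the Sherman–Morrison formula and the matrix determinant lemma. -/
lemma mixture_succ (v : ℕ → Fin D → ℝ) (η : ℕ → ℝ) (t : ℕ) :
    mixture v η (t + 1) = mixture v η t *
      (√(1 + v (t + 1) ⬝ᵥ (gram 1 v t)⁻¹.mulVec (v (t + 1))))⁻¹ *
      exp ((2 * η (t + 1) * (noiseSum v η t ⬝ᵥ (gram 1 v t)⁻¹.mulVec (v (t + 1)))
        + η (t + 1) ^ 2 * (v (t + 1) ⬝ᵥ (gram 1 v t)⁻¹.mulVec (v (t + 1)))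
        - (noiseSum v η t ⬝ᵥ (gram 1 v t)⁻¹.mulVec (v (t + 1))) ^ 2) /
        (2 * (1 + v (t + 1) ⬝ᵥ (gram 1 v t)⁻¹.mulVec (v (t + 1))))) := by
  have hA := posDef_gram_one v t
  have hu := dotProduct_inv_mulVec_nonneg hA (v (t + 1))
  rw [mixture, mixture, gram_succ, noiseSum_succ, det_add_vecMulVec_self hA,
    dotProduct_inv_add_vecMulVec_self hA, sqrt_mul hA.det_pos.le, mul_inv]
  simp only [Matrix.mulVec_add, Matrix.mulVec_smul, add_dotProduct, dotProduct_add,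
    smul_dotProduct, dotProduct_smul, smul_eq_mul,
    dotProduct_inv_mulVec_comm hA (v (t + 1)) (noiseSum v η t)]
  rw [mul_assoc, mul_assoc, mul_assoc, mul_left_comm (exp _), ← exp_add]
  congr 3
  field_simp
  ring

variable {W : Type*} {mW : MeasurableSpace W} {P : Measure W} [IsProbabilityMeasure P]
  {ℱ : Filtration ℕ mW} {T : ℕ} {v : ℕ → W → Fin D → ℝ} {η : ℕ → W → ℝ}

lemma measurable_gram_apply (hv : ∀ t ∈ Finset.Icc 1 T, Measurable[ℱ t] (v t)) {t n : ℕ}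
    (ht : t ≤ T) (htn : t ≤ n) (i j : Fin D) :
    Measurable[ℱ n] fun ω => gram 1 (fun s => v s ω) t i j := by
  simp only [gram, Matrix.add_apply, Matrix.sum_apply, Matrix.vecMulVec_apply]
  refine (measurable_const).add (Finset.measurable_sum _ fun s hs => ?_)
  rw [Finset.mem_Icc] at hs
  have := (hv s (Finset.mem_Icc.mpr ⟨hs.1, hs.2.trans ht⟩)).mono (ℱ.mono (hs.2.trans htn)) le_rfl
  fun_prop

lemma measurable_noiseSum (hv : ∀ t ∈ Finset.Icc 1 T, Measurable[ℱ t] (v t))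
    (hη : ∀ t ∈ Finset.Icc 1 T, Measurable[ℱ (t + 1)] (η t)) {t : ℕ} (ht : t ≤ T) :
    Measurable[ℱ (t + 1)] fun ω => noiseSum (fun s => v s ω) (fun s => η s ω) t := by
  refine Finset.measurable_sum _ fun s hs => ?_
  rw [Finset.mem_Icc] at hs
  have hs' := Finset.mem_Icc.mpr ⟨hs.1, hs.2.trans ht⟩
  exact ((hη s hs').mono (ℱ.mono (by omega)) le_rfl).smul
    ((hv s hs').mono (ℱ.mono (by omega)) le_rfl)

lemma measurable_mixture (hv : ∀ t ∈ Finset.Icc 1 T, Measurable[ℱ t] (v t))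
    (hη : ∀ t ∈ Finset.Icc 1 T, Measurable[ℱ (t + 1)] (η t)) {t : ℕ} (ht : t ≤ T) :
    Measurable[ℱ (t + 1)] fun ω => mixture (fun s => v s ω) (fun s => η s ω) t := by
  have hA := fun i j => measurable_gram_apply hv ht (Nat.le_succ t) i j
  have hS := measurable_noiseSum hv hη ht
  exact (@measurable_matrix_det _ _ (ℱ (t + 1)) _ _ _ hA).sqrt.inv.mul
    ((@measurable_dotProduct_inv_mulVec _ _ (ℱ (t + 1)) _ _ _ hA _ _ hS hS).div_const _).exp

/-- The supermartingale property of the mixture process. The process after round `t` is measurable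
with respect to `ℱ (t + 1)`, since rewards are observed after the arm is chosen. -/
lemma setLIntegral_mixture_succ_le (hv : ∀ t ∈ Finset.Icc 1 T, Measurable[ℱ t] (v t))
    (hη : ∀ t ∈ Finset.Icc 1 T, Measurable[ℱ (t + 1)] (η t))
    (hsub : ∀ t ∈ Finset.Icc 1 T, IsCondSubGaussianOne (ℱ t) P (η t)) {t : ℕ} (ht : t < T)
    {E : Set W} (hE : MeasurableSet[ℱ (t + 1)] E) :
    ∫⁻ ω in E, ENNReal.ofReal (mixture (fun s => v s ω) (fun s => η s ω) (t + 1)) ∂P ≤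
      ∫⁻ ω in E, ENNReal.ofReal (mixture (fun s => v s ω) (fun s => η s ω) t) ∂P := by
  have hmem : t + 1 ∈ Finset.Icc 1 T := Finset.mem_Icc.mpr ⟨by omega, ht⟩
  have hm : ℱ (t + 1) ≤ mW := ℱ.le _
  have hA := fun i j => measurable_gram_apply hv ht.le (Nat.le_succ t) i j
  have hS := measurable_noiseSum hv hη ht.le
  set u : W → ℝ := fun ω =>
    v (t + 1) ω ⬝ᵥ (gram 1 (fun s => v s ω) t)⁻¹.mulVec (v (t + 1) ω) with hu
  set c : W → ℝ := fun ω => noiseSum (fun s => v s ω) (fun s => η s ω) t ⬝ᵥ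
    (gram 1 (fun s => v s ω) t)⁻¹.mulVec (v (t + 1) ω) with hc
  have hum : Measurable[ℱ (t + 1)] u :=
    @measurable_dotProduct_inv_mulVec _ _ (ℱ (t + 1)) _ _ _ hA _ _ (hv _ hmem) (hv _ hmem)
  have hcm : Measurable[ℱ (t + 1)] c :=
    @measurable_dotProduct_inv_mulVec _ _ (ℱ (t + 1)) _ _ _ hA _ _ hS (hv _ hmem)
  have hu0 : ∀ ω, 0 ≤ u ω := fun ω =>
    dotProduct_inv_mulVec_nonneg (posDef_gram_one (fun s => v s ω) t) _
  set h : W → ENNReal := E.indicator fun ω =>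
    ENNReal.ofReal (mixture (fun s => v s ω) (fun s => η s ω) t * (√(1 + u ω))⁻¹) with hh
  have hhm : Measurable[ℱ (t + 1)] h := Measurable.indicator
    (((measurable_mixture hv hη ht.le).mul
      (measurable_const.add hum).sqrt.inv).ennreal_ofReal) hE
  have key := (hsub _ hmem).lintegral_mul_exp_quadratic_le hm
    ((hη _ hmem).mono (ℱ.le _) le_rfl) hcm hum hu0 hhm
  rw [← lintegral_indicator (hm _ hE), ← lintegral_indicator (hm _ hE)]
  refine le_of_eq_of_le (lintegral_congr fun ω => ?_) (key.trans_eq (lintegral_congr fun ω => ?_))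
  · by_cases hω : ω ∈ E
    · simp only [hh, Set.indicator_of_mem hω]
      rw [mixture_succ, ENNReal.ofReal_mul]
      exact mul_nonneg (mixture_nonneg _ _ _) (by positivity)
    · simp [hh, hω]
  · by_cases hω : ω ∈ E
    · simp only [hh, Set.indicator_of_mem hω]
      have : √(1 + u ω) ≠ 0 := (sqrt_pos.mpr (by linarith [hu0 ω])).ne'
      rw [← ENNReal.ofReal_mul' (sqrt_nonneg _), mul_assoc, inv_mul_cancel₀ this, mul_one]
    · simp [hh, hω]

/-- The self-normalized tail bound for vector-valued martingales, for noise with variance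
proxy `1`. -/
lemma measure_exists_log_lt_noiseSum_le (hv : ∀ t ∈ Finset.Icc 1 T, Measurable[ℱ t] (v t))
    (hη : ∀ t ∈ Finset.Icc 1 T, Measurable[ℱ (t + 1)] (η t))
    (hsub : ∀ t ∈ Finset.Icc 1 T, IsCondSubGaussianOne (ℱ t) P (η t)) {δ : ℝ} (hδ : 0 < δ) :
    P {ω | ∃ t ≤ T, log ((gram 1 (fun s => v s ω) t).det / δ ^ 2) <
      mahalanobis (gram 1 (fun s => v s ω) t)⁻¹
        (noiseSum (fun s => v s ω) (fun s => η s ω) t) ^ 2} ≤ ENNReal.ofReal δ := by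
  let 𝒢 : Filtration ℕ mW := ⟨fun t => ℱ (t + 1), fun i j hij => ℱ.mono (by omega), fun _ => ℱ.le _⟩
  have key := mul_measure_exists_lt_le P 𝒢 T
    (fun t ω => ENNReal.ofReal (mixture (fun s => v s ω) (fun s => η s ω) t))
    (fun t ht => (measurable_mixture hv hη ht).ennreal_ofReal)
    (fun t ht E hE => setLIntegral_mixture_succ_le hv hη hsub ht hE) (ENNReal.ofReal δ⁻¹)
  have h0 : ∫⁻ ω, ENNReal.ofReal (mixture (fun s => v s ω) (fun s => η s ω) 0) ∂P = 1 := by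
    simp [mixture, noiseSum]
  rw [h0] at key
  have hP : P {ω | ∃ t ≤ T, ENNReal.ofReal δ⁻¹ <
      ENNReal.ofReal (mixture (fun s => v s ω) (fun s => η s ω) t)} ≤ ENNReal.ofReal δ := by
    rw [ENNReal.ofReal_inv_of_pos hδ, mul_comm, ← div_eq_mul_inv] at key
    rw [ENNReal.ofReal_inv_of_pos hδ]
    simpa using (ENNReal.div_le_iff (by simpa using hδ) ENNReal.ofReal_ne_top).mp key
  refine (measure_mono ?_).trans hP
  rintro ω ⟨t, ht, h⟩
  refine ⟨t, ht, ?_⟩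
  have hd := (posDef_gram_one (fun s => v s ω) t).det_pos
  rw [ENNReal.ofReal_lt_ofReal_iff_of_nonneg (by positivity), mixture]
  rw [mahalanobis_inv_gram_sq, log_div hd.ne' (by positivity), log_pow] at h
  rw [← log_lt_log_iff (by positivity) (by positivity), log_inv,
    log_mul (by positivity) (by positivity), log_exp, log_inv, log_sqrt hd.le]
  push_cast at h
  linarith

lemma mahalanobis_smul (M : Matrix (Fin D) (Fin D) ℝ) {r : ℝ} (hr : 0 ≤ r) (w : Fin D → ℝ) :
    mahalanobis M (r • w) = r * mahalanobis M w := by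
  rw [mahalanobis, mahalanobis, Matrix.mulVec_smul, smul_dotProduct, dotProduct_smul, smul_eq_mul,
    smul_eq_mul, ← mul_assoc, sqrt_mul (mul_self_nonneg r), sqrt_mul_self hr]

/-- Noise that is sub-Gaussian with variance proxy `0` vanishes almost surely: the expectation of
`cosh η` is at most `1`. -/
lemma ae_eq_zero_of_condExp_exp_le_one {m : MeasurableSpace W} (hm : m ≤ mW) {ζ : W → ℝ}
    (hint : ∀ c : ℝ, Integrable (fun ω => exp (c * ζ ω)) P)
    (hle : ∀ c : ℝ, P[fun ω => exp (c * ζ ω) | m] ≤ᵐ[P] fun _ => 1) : ζ =ᵐ[P] 0 := by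
  have hI : ∀ c : ℝ, ∫ ω, exp (c * ζ ω) ∂P ≤ 1 := fun c => by
    rw [← integral_condExp hm]
    calc _ ≤ ∫ _, (1 : ℝ) ∂P := integral_mono_ae integrable_condExp (integrable_const _) (hle c)
      _ = 1 := by simp
  have e : (fun ω => cosh (ζ ω) - 1) = fun ω => (exp (1 * ζ ω) + exp (-1 * ζ ω)) / 2 - 1 := by
    ext ω; rw [cosh_eq]; simp
  have hint2 : Integrable (fun ω => cosh (ζ ω) - 1) P := by
    rw [e]; exact (((hint 1).add (hint (-1))).div_const 2).sub (integrable_const _)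
  have hnn : 0 ≤ fun ω => cosh (ζ ω) - 1 := fun ω => by simp
  have h0 : ∫ ω, (cosh (ζ ω) - 1) ∂P = 0 := by
    refine le_antisymm ?_ (integral_nonneg hnn)
    have hadd : Integrable (fun ω => exp (1 * ζ ω) + exp (-1 * ζ ω)) P := (hint 1).add (hint (-1))
    rw [e, integral_sub (hadd.div_const 2) (integrable_const _),
      integral_div, integral_add (hint 1) (hint (-1))]
    have h1 := hI 1
    have h2 := hI (-1)
    simp only [integral_const, probReal_univ, smul_eq_mul, mul_one]
    linarith
  filter_upwards [(integral_eq_zero_iff_of_nonneg hnn hint2).mp h0] with ω hω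
  by_contra hne
  have := one_lt_cosh.mpr hne
  simp only [Pi.zero_apply] at hω
  linarith

/-- The self-normalized tail bound for conditionally `R`-sub-Gaussian noise. -/
lemma one_sub_le_measureReal_noiseSum_le (hv : ∀ t ∈ Finset.Icc 1 T, Measurable[ℱ t] (v t))
    (hη : ∀ t ∈ Finset.Icc 1 T, Measurable[ℱ (t + 1)] (η t)) {R : ℝ} (hR : 0 ≤ R)
    (hint : ∀ t ∈ Finset.Icc 1 T, ∀ c : ℝ, Integrable (fun ω => exp (c * η t ω)) P)
    (hsub : ∀ t ∈ Finset.Icc 1 T, ∀ c : ℝ,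
      P[fun ω => exp (c * η t ω) | ℱ t] ≤ᵐ[P] fun _ => exp (c ^ 2 * R ^ 2 / 2))
    {δ : ℝ} (hδ : 0 < δ) :
    1 - δ ≤ P.real {ω | ∀ t ≤ T, mahalanobis (gram 1 (fun s => v s ω) t)⁻¹
        (noiseSum (fun s => v s ω) (fun s => η s ω) t) ≤
      R * √(log ((gram 1 (fun s => v s ω) t).det / δ ^ 2))} := by
  -- the noise vanishes for `R = 0`, and is rescaled to variance proxy `1` for `R > 0`
  rcases hR.eq_or_lt with rfl | hR
  · have h0 : ∀ᵐ ω ∂P, ∀ t ∈ Finset.Icc 1 T, η t ω = 0 := by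
      rw [Finset.eventually_all]
      exact fun t ht => ae_eq_zero_of_condExp_exp_le_one (ℱ.le t) (hint t ht)
        fun c => by simpa using hsub t ht c
    have h1 : ∀ᵐ ω ∂P, ω ∈ {ω | ∀ t ≤ T, mahalanobis (gram 1 (fun s => v s ω) t)⁻¹
        (noiseSum (fun s => v s ω) (fun s => η s ω) t) ≤
      0 * √(log ((gram 1 (fun s => v s ω) t).det / δ ^ 2))} := by
      filter_upwards [h0] with ω hω t ht
      have : noiseSum (fun s => v s ω) (fun s => η s ω) t = 0 :=
        Finset.sum_eq_zero fun s hs => by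
          rw [Finset.mem_Icc] at hs
          simp [hω s (Finset.mem_Icc.mpr ⟨hs.1, hs.2.trans ht⟩)]
      simp [this, mahalanobis]
    have h2 := measureReal_congr (eventuallyEq_univ.mpr h1)
    rw [probReal_univ] at h2
    exact le_trans (by linarith) h2.symm.le
  · set ζ : ℕ → W → ℝ := fun t ω => R⁻¹ * η t ω with hζ
    have key := measure_exists_log_lt_noiseSum_le (η := ζ) (P := P) hv
      (fun t ht => (hη t ht).const_mul _)
      (fun t ht => ⟨fun c => by simpa [hζ, mul_assoc] using hint t ht (c * R⁻¹), fun c => by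
        have := hsub t ht (c * R⁻¹)
        have e : (c * R⁻¹) ^ 2 * R ^ 2 / 2 = c ^ 2 / 2 := by field_simp
        rw [e] at this
        simpa [hζ, mul_assoc] using this⟩) hδ
    set Bad := {ω | ∃ t ≤ T, log ((gram 1 (fun s => v s ω) t).det / δ ^ 2) <
      mahalanobis (gram 1 (fun s => v s ω) t)⁻¹
        (noiseSum (fun s => v s ω) (fun s => ζ s ω) t) ^ 2} with hBad
    have hreal : P.real Bad ≤ δ := ENNReal.toReal_le_of_le_ofReal hδ.le key
    have hcompl : 1 - P.real Bad ≤ P.real Badᶜ := by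
      have := measureReal_union_le (μ := P) Bad Badᶜ
      rw [Set.union_compl_self, probReal_univ] at this
      linarith
    have hsubset : Badᶜ ⊆ {ω | ∀ t ≤ T, mahalanobis (gram 1 (fun s => v s ω) t)⁻¹
        (noiseSum (fun s => v s ω) (fun s => η s ω) t) ≤
      R * √(log ((gram 1 (fun s => v s ω) t).det / δ ^ 2))} := by
      intro ω hω t ht
      simp only [hBad, Set.mem_compl_iff, Set.mem_ofPred_eq, not_exists, not_and, not_lt] at hω
      have e : noiseSum (fun s => v s ω) (fun s => η s ω) t =
          R • noiseSum (fun s => v s ω) (fun s => ζ s ω) t := by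
        simp only [noiseSum, Finset.smul_sum, hζ, smul_smul, mul_inv_cancel_left₀ hR.ne']
      rw [e, mahalanobis_smul _ hR.le]
      gcongr
      exact le_sqrt_of_sq_le (hω t ht)
    linarith [measureReal_mono (μ := P) hsubset]

end SelfNormalized

/-! ### The Newton basis in the reproducing kernel Hilbert space -/

section Newton

variable {X H : Type*} [NormedAddCommGroup H] [InnerProductSpace ℝ H] [CompleteSpace H]
  [RKHS ℝ H X ℝ]

variable (H) in
/-- The representer `K(·, x)` of the evaluation at `x`. -/
noncomputable def kerVec (x : X) : H := RKHS.kerFun H x (1 : ℝ)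

lemma inner_kerVec_left (x : X) (f : H) : inner ℝ (kerVec H x) f = f x := by
  simp [kerVec]

lemma inner_kerVec_right (x : X) (f : H) : inner ℝ f (kerVec H x) = f x := by
  simp [kerVec]

variable {K : X → X → ℝ} (hH : ∀ x y, RKHS.kernel H x y 1 = K x y)

include hH

lemma kerVec_apply (x y : X) : kerVec H y x = K x y := by
  rw [kerVec, RKHS.kerFun_apply, hH]

lemma inner_kerVec (x y : X) : inner ℝ (kerVec H x) (kerVec H y) = K x y := by
  rw [inner_kerVec_left, kerVec_apply hH]

omit hH

variable (H) in
/-- The Newton basis function `newton K ξ m` as an element of the RKHS. -/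
noncomputable def newtonVec (K : X → X → ℝ) (ξ : ℕ → X) (m : ℕ) : H :=
  (√(powerSq K ξ m (ξ m)))⁻¹ •
    (kerVec H (ξ m) - ∑ k : Fin m, newton K ξ k (ξ m) • newtonVec K ξ k)
termination_by m
decreasing_by all_goals exact k.isLt

lemma rkhs_sum_smul_apply {ι : Type*} (s : Finset ι) (c : ι → ℝ) (e : ι → H) (x : X) :
    (∑ i ∈ s, c i • e i) x = ∑ i ∈ s, c i * e i x := by
  simp_rw [← inner_kerVec_left, inner_sum, inner_smul_right]

include hH

lemma newtonVec_apply (ξ : ℕ → X) (m : ℕ) (x : X) : newtonVec H K ξ m x = newton K ξ m x := by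
  induction m using Nat.strong_induction_on with
  | _ m ih =>
    rw [newtonVec, newton, RKHS.coe_smul, Pi.smul_apply, RKHS.coe_sub, Pi.sub_apply,
      kerVec_apply hH, rkhs_sum_smul_apply, smul_eq_mul, inv_mul_eq_div]
    simp_rw [powerSq, ih _ (Fin.isLt _)]

/-- The Newton basis is the Gram–Schmidt orthonormalization of the representers of the points. -/
lemma inner_newtonVec {ξ : ℕ → X} {D : ℕ} (hpos : ∀ m < D, 0 < powerSq K ξ m (ξ m)) :
    ∀ m < D, ∀ j ≤ m, inner ℝ (newtonVec H K ξ j) (newtonVec H K ξ m) =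
      if j = m then 1 else 0 := by
  intro m
  induction m using Nat.strong_induction_on with
  | _ m ih =>
    intro hm
    have hortho : ∀ j k : ℕ, j < m → k < m →
        inner ℝ (newtonVec H K ξ j) (newtonVec H K ξ k) = if j = k then (1 : ℝ) else 0 := by
      intro j k hj hk
      rcases le_total j k with h | h
      · exact ih k hk (hk.trans hm) j h
      · rw [real_inner_comm, ih j hj (hj.trans hm) k h]
        simp only [eq_comm]
    set w := kerVec H (ξ m) - ∑ k : Fin m, newton K ξ k (ξ m) • newtonVec H K ξ k with hw
    have hdef : newtonVec H K ξ m = (√(powerSq K ξ m (ξ m)))⁻¹ • w := by rw [newtonVec]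
    have hjw : ∀ j < m, inner ℝ (newtonVec H K ξ j) w = 0 := by
      intro j hj
      rw [hw, inner_sub_right, inner_kerVec_right, newtonVec_apply hH, inner_sum]
      simp_rw [inner_smul_right, fun k : Fin m => hortho j k hj k.isLt]
      rw [Finset.sum_eq_single ⟨j, hj⟩]
      · simp
      · intro k _ hk
        rw [if_neg fun h => hk (Fin.ext h.symm), mul_zero]
      · simp
    have hww : inner ℝ w w = powerSq K ξ m (ξ m) := by
      rw [show inner ℝ w w = inner ℝ (kerVec H (ξ m) -
        ∑ k : Fin m, newton K ξ k (ξ m) • newtonVec H K ξ k) w by rw [← hw],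
        inner_sub_left, sum_inner]
      simp_rw [inner_smul_left, fun k : Fin m => hjw k k.isLt]
      rw [inner_kerVec_left, hw, RKHS.coe_sub, Pi.sub_apply, kerVec_apply hH, rkhs_sum_smul_apply,
        powerSq]
      simp_rw [newtonVec_apply hH, sq]
      simp
    intro j hj
    rcases hj.eq_or_lt with rfl | hj
    · rw [if_pos rfl, hdef, inner_smul_left, inner_smul_right, hww, conj_trivial, ← mul_assoc,
        ← mul_inv, Real.mul_self_sqrt (hpos _ hm).le, inv_mul_cancel₀ (hpos _ hm).ne']
    · rw [if_neg hj.ne, hdef, inner_smul_right, hjw j hj, mul_zero]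

lemma orthonormal_newtonVec {ξ : ℕ → X} {D : ℕ} (hpos : ∀ m < D, 0 < powerSq K ξ m (ξ m)) :
    Orthonormal ℝ fun j : Fin D => newtonVec H K ξ j := by
  rw [orthonormal_iff_ite]
  intro i j
  rcases le_total i j with h | h
  · rw [inner_newtonVec hH hpos j j.isLt i h]
    simp [Fin.ext_iff]
  · rw [real_inner_comm, inner_newtonVec hH hpos i i.isLt j h]
    simp [Fin.ext_iff, eq_comm]

omit hH

variable (H) in
/-- The component of the representer of `x` orthogonal to the first `D` Newton basis functions. -/
noncomputable def newtonResidual (K : X → X → ℝ) (ξ : ℕ → X) (D : ℕ) (x : X) : H :=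
  kerVec H x - ∑ j : Fin D, newton K ξ j x • newtonVec H K ξ j

include hH

lemma inner_newtonResidual {ξ : ℕ → X} {D : ℕ} (hpos : ∀ m < D, 0 < powerSq K ξ m (ξ m))
    (x y : X) : inner ℝ (newtonResidual H K ξ D x) (newtonResidual H K ξ D y) =
      K x y - feature K ξ D x ⬝ᵥ feature K ξ D y := by
  have ho := orthonormal_iff_ite.mp (orthonormal_newtonVec hH hpos)
  rw [newtonResidual, newtonResidual, inner_sub_left, inner_sub_right, inner_sub_right,
    inner_kerVec hH, inner_kerVec_left, inner_kerVec_right, rkhs_sum_smul_apply,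
    rkhs_sum_smul_apply]
  simp_rw [sum_inner, inner_sum, inner_smul_left, inner_smul_right, ho, newtonVec_apply hH]
  simp [feature, dotProduct, mul_comm]

lemma norm_newtonResidual_sq {ξ : ℕ → X} {D : ℕ} (hpos : ∀ m < D, 0 < powerSq K ξ m (ξ m))
    (x : X) : ‖newtonResidual H K ξ D x‖ ^ 2 = powerSq K ξ D x := by
  rw [← real_inner_self_eq_norm_sq, inner_newtonResidual hH hpos, powerSq]
  simp [feature, dotProduct, sq]

lemma feature_dotProduct_self_le {ξ : ℕ → X} {D : ℕ} (hpos : ∀ m < D, 0 < powerSq K ξ m (ξ m))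
    (x : X) : feature K ξ D x ⬝ᵥ feature K ξ D x ≤ K x x := by
  have := inner_newtonResidual hH hpos x x
  rw [real_inner_self_eq_norm_sq] at this
  linarith [sq_nonneg ‖newtonResidual H K ξ D x‖]

/-- Up to an error controlled by the power function, an element of the RKHS is linear in the
Newton features; the coefficient vector is that of the orthogonal projection. -/
lemma exists_coeff_abs_sub_le {ξ : ℕ → X} {D : ℕ} (hpos : ∀ m < D, 0 < powerSq K ξ m (ξ m))
    (f : H) : ∃ θ : Fin D → ℝ, θ ⬝ᵥ θ ≤ ‖f‖ ^ 2 ∧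
      ∀ x, |f x - feature K ξ D x ⬝ᵥ θ| ≤ ‖f‖ * √(powerSq K ξ D x) := by
  refine ⟨fun j => inner ℝ (newtonVec H K ξ j) f, ?_, fun x => ?_⟩
  · have := (orthonormal_newtonVec hH hpos).sum_inner_products_le (s := Finset.univ) f
    simpa [dotProduct, sq] using this
  · have e : f x - feature K ξ D x ⬝ᵥ (fun j : Fin D => inner ℝ (newtonVec H K ξ j) f) =
        inner ℝ (newtonResidual H K ξ D x) f := by
      rw [newtonResidual, inner_sub_left, inner_kerVec_left, sum_inner]
      simp [dotProduct, feature, inner_smul_left]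
    rw [e, ← norm_newtonResidual_sq hH hpos, Real.sqrt_sq (norm_nonneg _), mul_comm]
    exact abs_real_inner_le_norm _ _

omit hH

/-- The algorithm never divides by zero: as long as the stopping test fails, the maximum of the power
function is positive, and for the first point positivity is that of `K(ξ_0, ξ_0)`. -/
lemma IsPGreedyOutput.powerSq_pos {K : X → X → ℝ} (hK : IsPosDefKernel K) {A : Set X} {e : ℝ}
    (he : 0 < e) {D : ℕ} {ξ : ℕ → X} (h : IsPGreedyOutput K A e D ξ) :
    ∀ m < D, 0 < powerSq K ξ m (ξ m) := by
  intro m hm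
  rcases Nat.eq_zero_or_pos m with rfl | hm0
  · have := (hK.2 1 (fun _ => ξ 0) fun _ _ _ => Subsingleton.elim _ _).det_pos
    simpa [powerSq] using this
  · obtain ⟨x, hx, hle⟩ := h.not_terminated m hm0 hm
    exact (pow_pos he 2).trans_le (hle.trans (h.argmax m hm x hx))

lemma measurable_newton [MeasurableSpace X] {K : X → X → ℝ} (hK : ∀ y, Measurable fun x => K x y)
    (ξ : ℕ → X) (m : ℕ) : Measurable (newton K ξ m) := by
  induction m using Nat.strong_induction_on with
  | _ m ih =>
    have : newton K ξ m = fun x => (K x (ξ m) - ∑ k : Fin m, newton K ξ k (ξ m) * newton K ξ k x) /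
      √(K (ξ m) (ξ m) - ∑ k : Fin m, newton K ξ k (ξ m) ^ 2) := by
      ext x; rw [newton]
    rw [this]
    exact ((hK _).sub (Finset.measurable_sum _ fun (k : Fin m) _ =>
      (ih k k.isLt).const_mul _)).div_const _

lemma measurable_feature [MeasurableSpace X] {K : X → X → ℝ}
    (hK : ∀ y, Measurable fun x => K x y) (ξ : ℕ → X) (D : ℕ) : Measurable (feature K ξ D) :=
  measurable_pi_lambda _ fun i => measurable_newton hK ξ i

include hH

/-- Every element of the RKHS is a pointwise limit of linear combinations of representers. -/
lemma measurable_of_measurable_kernel [MeasurableSpace X] (hK : ∀ y, Measurable fun x => K x y)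
    (f : H) : Measurable f := by
  have hf : f ∈ closure (Submodule.span ℝ {RKHS.kerFun H x v | (x : X) (v : ℝ)} : Set H) := by
    rw [← Submodule.topologicalClosure_coe, RKHS.kerFun_dense]
    trivial
  obtain ⟨g, hg, hlim⟩ := mem_closure_iff_seq_limit.mp hf
  refine measurable_of_tendsto_metrizable (f := fun n => (g n : X → ℝ)) (fun n => ?_)
    (tendsto_pi_nhds.mpr fun x => ((RKHS.continuous_eval x).tendsto f).comp hlim)
  have hn := hg n
  generalize g n = u at hn
  induction hn using Submodule.span_induction with
  | mem h hh =>
    obtain ⟨y, c, rfl⟩ := hh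
    have : (RKHS.kerFun H y c : X → ℝ) = fun x => c * K x y := by
      ext x
      rw [← kerVec_apply hH, kerVec, ← smul_eq_mul, ← Pi.smul_apply, ← RKHS.coe_smul, ← map_smul,
        smul_eq_mul, mul_one]
    rw [this]
    exact (hK y).const_mul c
  | zero => rw [RKHS.coe_zero]; exact measurable_const
  | add a b _ _ ha hb => rw [RKHS.coe_add]; exact ha.add hb
  | smul c a _ ha => rw [RKHS.coe_smul]; exact ha.const_smul c

end Newton

/-! ### Information gain -/

section InfoGain

variable {X H : Type*} [NormedAddCommGroup H] [InnerProductSpace ℝ H] [CompleteSpace H]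
  [RKHS ℝ H X ℝ] {K : X → X → ℝ} (hH : ∀ x y, RKHS.kernel H x y 1 = K x y)

include hH

lemma posSemidef_kernelMatrix {n : ℕ} (x : Fin n → X) :
    (Matrix.of fun i j => K (x i) (x j)).PosSemidef := by
  have : (Matrix.of fun i j => K (x i) (x j)) = Matrix.gram ℝ fun i => kerVec H (x i) := by
    ext i j; simp [Matrix.gram_apply, inner_kerVec hH]
  rw [this]
  exact Matrix.posSemidef_gram ℝ _

lemma posDef_one_add_kernelMatrix {n : ℕ} (x : Fin n → X) :
    (1 + Matrix.of fun i j => K (x i) (x j)).PosDef :=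
  Matrix.PosDef.one.add_posSemidef (posSemidef_kernelMatrix hH x)

/-- By `log det M ≤ tr M - n`, applied to `M = 1 + K_x`. -/
lemma infoGain_le (hK_le : ∀ x, K x x ≤ 1) {n : ℕ} (x : Fin n → X) :
    infoGain K 1 x ≤ n / 2 := by
  have h := log_det_le_trace_sub_card (posDef_one_add_kernelMatrix hH x)
  have h2 : (Matrix.of fun i j => K (x i) (x j)).trace ≤ n := by
    rw [Matrix.trace]
    calc _ ≤ ∑ _i : Fin n, (1 : ℝ) := Finset.sum_le_sum fun i _ => hK_le (x i)
      _ = n := by simp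
  rw [Matrix.trace_add, Matrix.trace_one] at h
  rw [infoGain, inv_one, one_smul]
  linarith

lemma bddAbove_infoGain (hK_le : ∀ x, K x x ≤ 1) (A : Set X) (T : ℕ) :
    BddAbove (Set.range fun x : Fin T → A => infoGain K 1 fun i => (x i : X)) :=
  ⟨T / 2, by rintro _ ⟨x, rfl⟩; exact infoGain_le hH hK_le _⟩

lemma maxInfoGain_le (hK_le : ∀ x, K x x ≤ 1) {A : Set X} (hA : A.Nonempty) (T : ℕ) :
    maxInfoGain K A 1 T ≤ T / 2 := by
  have := hA.to_subtype
  exact ciSup_le fun x => infoGain_le hH hK_le _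

/-- Playing the same arm `a` in every round gives the information gain
`log (1 + T K(a, a)) / 2`. -/
lemma log_le_maxInfoGain (hK_le : ∀ x, K x x ≤ 1) {A : Set X} {a : X} (ha : a ∈ A)
    (ha0 : 0 ≤ K a a) (T : ℕ) :
    1 / 2 * Real.log (1 + T * K a a) ≤ maxInfoGain K A 1 T := by
  refine le_of_eq_of_le ?_ (le_ciSup (bddAbove_infoGain hH hK_le A T) fun _ => ⟨a, ha⟩)
  have e : (Matrix.of fun _ _ : Fin T => K a a) =
      Matrix.vecMulVec (fun _ => √(K a a)) (fun _ => √(K a a)) := by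
    ext i j; simp [Matrix.vecMulVec_apply, Real.mul_self_sqrt ha0]
  rw [infoGain, inv_one, one_smul, e, det_add_vecMulVec_self Matrix.PosDef.one]
  simp [dotProduct, Real.mul_self_sqrt ha0]

/-- The matrix `1 + V Vᵀ` of the features has the determinant of `A_T = 1 + Vᵀ V`, and the kernel
matrix exceeds `V Vᵀ` by the Gram matrix of the residuals. -/
lemma log_det_gram_le_maxInfoGain (hK_le : ∀ x, K x x ≤ 1) {ξ : ℕ → X} {D : ℕ}
    (hpos : ∀ m < D, 0 < powerSq K ξ m (ξ m)) {A : Set X} {T : ℕ} {x : ℕ → X}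
    (hx : ∀ t < T, x (t + 1) ∈ A) :
    Real.log (gram 1 (fun s => feature K ξ D (x s)) T).det ≤ 2 * maxInfoGain K A 1 T := by
  set V : Matrix (Fin T) (Fin D) ℝ := Matrix.of fun i => feature K ξ D (x (i + 1)) with hV
  have e1 : gram 1 (fun s => feature K ξ D (x s)) T = 1 + V.transpose * V := by
    rw [gram, one_smul]
    congr 1
    ext i j
    rw [Matrix.sum_apply, Matrix.mul_apply]
    simp only [Matrix.vecMulVec_apply, Matrix.transpose_apply, hV, Matrix.of_apply]
    rw [Fin.sum_univ_eq_sum_range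
      (fun s => feature K ξ D (x (s + 1)) i * feature K ξ D (x (s + 1)) j) T,
      Finset.range_eq_Ico, Finset.sum_Ico_add'
      (fun s => feature K ξ D (x s) i * feature K ξ D (x s) j), zero_add]
    rfl
  have hVV : (1 + V * V.transpose).PosDef := Matrix.PosDef.one.add_posSemidef
    (by simpa using Matrix.posSemidef_self_mul_conjTranspose V)
  have hres : (Matrix.gram ℝ fun i : Fin T => newtonResidual H K ξ D (x (i + 1))).PosSemidef :=
    Matrix.posSemidef_gram ℝ _
  have e2 : (1 + V * V.transpose) + Matrix.gram ℝ (fun i : Fin T => newtonResidual H K ξ D (x (i + 1)))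
      = 1 + Matrix.of fun i j : Fin T => K (x (i + 1)) (x (j + 1)) := by
    rw [add_assoc]
    congr 1
    ext i j
    rw [Matrix.add_apply, Matrix.gram_apply, inner_newtonResidual hH hpos]
    simp [hV, Matrix.mul_apply, dotProduct]
  have hdet := det_le_det_add_posSemidef hVV hres
  rw [e2, ← Matrix.det_one_add_mul_comm, ← e1] at hdet
  have hsup := le_ciSup (bddAbove_infoGain hH hK_le A T) fun i => ⟨x (i + 1), hx i i.isLt⟩
  have hlog := Real.log_le_log (posDef_gram_one _ T).det_pos hdet
  rw [infoGain, inv_one, one_smul] at hsup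
  rw [maxInfoGain]
  linarith

end InfoGain

/-! ### The regret of APG-UCB -/

section Regret

variable {D : ℕ} {v : ℕ → Fin D → ℝ} {y η : ℕ → ℝ} {θ : Fin D → ℝ}

/-- The confidence bound: if the rewards are linear in the features up to `ε` and the noise, and
the noise sum satisfies the self-normalized bound, then the estimate of `⟨w, θ⟩` is off by at most
the exploration bonus. -/
lemma abs_dotProduct_thetaHat_sub_le {R B δ ε : ℝ} (hB : 0 ≤ B) (hε : 0 ≤ ε)
    (hθ : θ ⬝ᵥ θ ≤ B ^ 2) {t : ℕ}
    (hy : ∀ s ∈ Finset.Icc 1 t, |y s - η s - v s ⬝ᵥ θ| ≤ ε)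
    (hnoise : mahalanobis (gram 1 v t)⁻¹ (noiseSum v η t) ≤
      R * √(Real.log ((gram 1 v t).det / δ ^ 2))) (w : Fin D → ℝ) :
    |w ⬝ᵥ thetaHat 1 v y t - w ⬝ᵥ θ| ≤
      mahalanobis (gram 1 v t)⁻¹ w * (beta 1 R B δ v t + ε * psi 1 v t) := by
  have hA := posDef_gram_one v t
  set M := gram 1 v t with hM
  set r : ℕ → ℝ := fun s => y s - η s - v s ⬝ᵥ θ with hr
  have hw0 := mahalanobis_nonneg M⁻¹ w
  -- `A_t θ = θ + ∑ ⟨v_s, θ⟩ v_s`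
  have hMθ : M.mulVec θ = θ + ∑ s ∈ Finset.Icc 1 t, (v s ⬝ᵥ θ) • v s := by
    rw [hM, gram, one_smul, Matrix.add_mulVec, Matrix.one_mulVec, Matrix.sum_mulVec]
    congr 1
    refine Finset.sum_congr rfl fun s _ => ?_
    rw [Matrix.vecMulVec_mulVec]
    ext i; simp [mul_comm]
  have hsum : ∑ s ∈ Finset.Icc 1 t, y s • v s =
      M.mulVec θ + noiseSum v η t + ∑ s ∈ Finset.Icc 1 t, r s • v s - θ := by
    rw [hMθ, noiseSum, add_assoc, add_assoc, add_sub_cancel_left, ← Finset.sum_add_distrib,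
      ← Finset.sum_add_distrib]
    refine Finset.sum_congr rfl fun s _ => ?_
    rw [hr, ← add_smul, ← add_smul]
    congr 1
    ring
  have hdiff : w ⬝ᵥ thetaHat 1 v y t - w ⬝ᵥ θ = w ⬝ᵥ M⁻¹.mulVec (noiseSum v η t) +
      ∑ s ∈ Finset.Icc 1 t, r s * (w ⬝ᵥ M⁻¹.mulVec (v s)) - w ⬝ᵥ M⁻¹.mulVec θ := by
    rw [thetaHat, hsum, Matrix.mulVec_sub, Matrix.mulVec_add, Matrix.mulVec_add,
      Matrix.mulVec_mulVec, Matrix.nonsing_inv_mul _ hA.det_pos.ne'.isUnit, Matrix.one_mulVec,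
      Matrix.mulVec_sum]
    simp only [dotProduct_sub, dotProduct_add, dotProduct_sum, Matrix.mulVec_smul, dotProduct_smul,
      smul_eq_mul]
    ring
  have h1 : |w ⬝ᵥ M⁻¹.mulVec (noiseSum v η t)| ≤
      mahalanobis M⁻¹ w * (R * √(Real.log (M.det / δ ^ 2))) :=
    (abs_dotProduct_inv_mulVec_le hA _ _).trans (mul_le_mul_of_nonneg_left hnoise hw0)
  have h2 : |∑ s ∈ Finset.Icc 1 t, r s * (w ⬝ᵥ M⁻¹.mulVec (v s))| ≤
      mahalanobis M⁻¹ w * (ε * psi 1 v t) := by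
    refine (Finset.abs_sum_le_sum_abs _ _).trans ?_
    rw [psi, Finset.mul_sum, Finset.mul_sum]
    refine Finset.sum_le_sum fun s hs => ?_
    rw [abs_mul, mul_left_comm]
    have hs' : s - 1 ≤ t := by rw [Finset.mem_Icc] at hs; omega
    refine mul_le_mul (hy s hs) ((abs_dotProduct_inv_mulVec_le hA _ _).trans ?_)
      (abs_nonneg _) hε
    exact mul_le_mul_of_nonneg_left (mahalanobis_inv_gram_antitone v (v s) hs') hw0
  have h3 : |w ⬝ᵥ M⁻¹.mulVec θ| ≤ mahalanobis M⁻¹ w * B := by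
    refine (abs_dotProduct_inv_mulVec_le hA _ _).trans (mul_le_mul_of_nonneg_left ?_ hw0)
    exact abs_le_of_sq_le_sq' ((mahalanobis_inv_gram_sq_le v t θ).trans hθ) hB |>.2
  have hbeta : beta 1 R B δ v t = R * √(Real.log (M.det / δ ^ 2)) + B := by
    simp [beta, hM]
  rw [hdiff, hbeta]
  calc _ ≤ |w ⬝ᵥ M⁻¹.mulVec (noiseSum v η t)| +
        |∑ s ∈ Finset.Icc 1 t, r s * (w ⬝ᵥ M⁻¹.mulVec (v s))| + |w ⬝ᵥ M⁻¹.mulVec θ| :=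
        (abs_sub _ _).trans (add_le_add_left (abs_add_le _ _) _)
    _ ≤ _ := by linarith

/-- The regret bound on the event where the self-normalized bound holds. -/
lemma regret_le_psi_mul {X : Type*} {K : X → X → ℝ} {A : Set X} (hA : A.Nonempty) {T : ℕ}
    {e R B δ : ℝ} {ξ x : ℕ → X} {f : X → ℝ} (he : 0 ≤ e) (hR : 0 ≤ R) (hB : 0 ≤ B) (hδ : 0 < δ)
    (hθ : θ ⬝ᵥ θ ≤ B ^ 2) (hf : ∀ z ∈ A, |f z - feature K ξ D z ⬝ᵥ θ| ≤ B * e)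
    (hy : ∀ t ∈ Finset.Icc 1 T, y t = f (x t) + η t)
    (hrun : IsAPGUCBRun K A T e 1 R B δ D ξ x y)
    (hnoise : ∀ t ≤ T, mahalanobis (gram 1 (fun s => feature K ξ D (x s)) t)⁻¹
        (noiseSum (fun s => feature K ξ D (x s)) η t) ≤
      R * √(Real.log ((gram 1 (fun s => feature K ξ D (x s)) t).det / δ ^ 2))) :
    regret A f T x ≤
      2 * psi 1 (fun s => feature K ξ D (x s)) T *
        (beta 1 R B δ (fun s => feature K ξ D (x s)) T +
          B * e * psi 1 (fun s => feature K ξ D (x s)) T) + 2 * (B * e) * T := by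
  have := hA.to_subtype
  set u : ℕ → Fin D → ℝ := fun s => feature K ξ D (x s) with hu
  have hε : 0 ≤ B * e := mul_nonneg hB he
  have hxA : ∀ s ∈ Finset.Icc 1 T, x s ∈ A := fun s hs => by
    rw [Finset.mem_Icc] at hs
    have := (hrun (s - 1) (by omega)).1
    rwa [Nat.sub_add_cancel hs.1] at this
  have hy' : ∀ s ∈ Finset.Icc 1 T, |y s - η s - u s ⬝ᵥ θ| ≤ B * e := fun s hs => by
    rw [hy s hs, add_sub_cancel_right]
    exact hf _ (hxA s hs)
  refine ciSup_le fun z => ?_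
  set b := beta 1 R B δ u T + B * e * psi 1 u T with hb
  have hstep : ∀ s ∈ Finset.Icc 1 T, f z - f (x s) ≤
      mahalanobis (gram 1 u (s - 1))⁻¹ (u s) * (2 * b) + 2 * (B * e) := by
    intro s hs
    have hs' := Finset.mem_Icc.mp hs
    obtain ⟨t, rfl⟩ : ∃ t, s = t + 1 := ⟨s - 1, by omega⟩
    rw [Nat.add_sub_cancel]
    have hconf := abs_dotProduct_thetaHat_sub_le (R := R) (δ := δ) hB hε hθ
      (fun s hs => hy' s (Finset.Icc_subset_Icc_right (by omega : t ≤ T) hs))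
      (hnoise t (by omega))
    -- optimism: `f z` is at most the upper confidence bound at `z`, hence at `x (t + 1)`
    have h1 := abs_le.mp (hconf (feature K ξ D z))
    have h2 := abs_le.mp (hconf (u (t + 1)))
    have h3 := (hrun t (by omega)).2 z z.2
    have h4 := abs_le.mp (hf z z.2)
    have h5 := abs_le.mp (hf _ (hxA _ hs))
    have hbt : beta 1 R B δ u t + B * e * psi 1 u t ≤ b :=
      add_le_add (beta_mono u hR hδ (by omega))
        (mul_le_mul_of_nonneg_left (psi_mono u (by omega)) hε)
    have h6 := mul_le_mul_of_nonneg_left hbt (mahalanobis_nonneg (gram 1 u t)⁻¹ (u (t + 1)))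
    simp only [ucb, ← hu] at h3
    change _ ≤ u (t + 1) ⬝ᵥ thetaHat 1 u y t + mahalanobis (gram 1 u t)⁻¹ (u (t + 1)) * _ at h3
    change -(B * e) ≤ f (x (t + 1)) - u (t + 1) ⬝ᵥ θ ∧ _ at h5
    linarith
  refine (Finset.sum_le_sum hstep).trans_eq ?_
  rw [Finset.sum_add_distrib, ← Finset.sum_mul, ← psi, Finset.sum_const, Nat.card_Icc,
    Nat.add_sub_cancel, nsmul_eq_mul]
  ring

lemma betaIGP_ge {B R δ γ : ℝ} (hR : 0 ≤ R) : B ≤ betaIGP B R δ γ :=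
  le_add_of_nonneg_right (mul_nonneg hR (Real.sqrt_nonneg _))

/-- The regret bound in terms of `γ`. It rests on `β_T ≤ β_T^{IGP-UCB}` and `ψ_T ≤ 2 √(γ T)`; the
lower bound `γ₀` on `γ` serves to absorb the term `2 ε T`, which has no factor `γ`. -/
lemma psi_mul_beta_le_regretBound {T : ℕ} (hT : 1 ≤ T) {α q B R δ γ γ₀ : ℝ} (hα : 0 ≤ α)
    (hB : 0 ≤ B) (hR : 0 ≤ R) (hδ : 0 < δ) (hγ₀ : 0 < γ₀) (hγ : γ₀ ≤ γ)
    (hv : ∀ t < T, v (t + 1) ⬝ᵥ v (t + 1) ≤ 1) (hdet : Real.log (gram 1 v T).det ≤ 2 * γ) :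
    2 * psi 1 v T * (beta 1 R B δ v T + B * (α / (T : ℝ) ^ q) * psi 1 v T) +
        2 * (B * (α / (T : ℝ) ^ q)) * T ≤
      4 * betaIGP B R δ γ * √(γ * T) + (8 * B * α + 2 * B * α / γ₀) *
        (√(T * γ) * (T : ℝ) ^ ((3 / 2 - q) / 2) + γ * (T : ℝ) ^ (1 - q)) := by
  have hT0 : (0 : ℝ) < T := by exact_mod_cast hT
  have hγ0 : 0 < γ := hγ₀.trans_le hγ
  have hψ0 := psi_nonneg v T
  have hψsq : psi 1 v T ^ 2 ≤ 4 * (γ * T) := by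
    have h1 := psi_sq_le v T hv
    have h2 : T * (2 * Real.log (gram 1 v T).det) ≤ T * (2 * (2 * γ)) := by gcongr
    linarith
  have hψ : psi 1 v T ≤ 2 * √(γ * T) := by
    refine abs_le_of_sq_le_sq' ?_ (by positivity) |>.2
    rw [mul_pow, Real.sq_sqrt (by positivity)]
    linarith
  have hβ : beta 1 R B δ v T ≤ betaIGP B R δ γ := by
    have h1 : Real.log ((gram 1 v T).det / δ ^ 2) ≤ 2 * (γ + 1 + Real.log (1 / δ)) := by
      rw [Real.log_div (posDef_gram_one v T).det_pos.ne' (by positivity), Real.log_pow, one_div,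
        Real.log_inv]
      push_cast
      linarith
    have h2 := mul_le_mul_of_nonneg_left (Real.sqrt_le_sqrt h1) hR
    simp only [beta, betaIGP, inv_one, one_smul, Real.sqrt_one, one_mul]
    linarith
  have hβ0 : 0 ≤ betaIGP B R δ γ := hB.trans (betaIGP_ge hR)
  have hmain : 2 * psi 1 v T * beta 1 R B δ v T ≤ 4 * betaIGP B R δ γ * √(γ * T) := by
    have h1 := mul_le_mul_of_nonneg_left hβ hψ0
    have h2 := mul_le_mul_of_nonneg_right hψ hβ0
    linarith
  have hpow : α / (T : ℝ) ^ q * T = α * (T : ℝ) ^ (1 - q) := by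
    rw [Real.rpow_sub hT0, Real.rpow_one]
    ring
  have hp : 0 < (T : ℝ) ^ (1 - q) := Real.rpow_pos_of_pos hT0 _
  have he : 0 ≤ B * (α / (T : ℝ) ^ q) :=
    mul_nonneg hB (div_nonneg hα (Real.rpow_nonneg hT0.le _))
  have hsecond : 2 * (B * (α / (T : ℝ) ^ q)) * psi 1 v T ^ 2 ≤
      8 * B * α * (γ * (T : ℝ) ^ (1 - q)) := by
    calc _ ≤ 2 * (B * (α / (T : ℝ) ^ q)) * (4 * (γ * T)) := by gcongr
      _ = 8 * B * γ * (α / (T : ℝ) ^ q * T) := by ring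
      _ = _ := by rw [hpow]; ring
  have hthird : 2 * (B * (α / (T : ℝ) ^ q)) * T ≤ 2 * B * α / γ₀ * (γ * (T : ℝ) ^ (1 - q)) := by
    calc _ = 2 * B * (α / (T : ℝ) ^ q * T) := by ring
      _ = 2 * B * α / γ₀ * (γ₀ * (T : ℝ) ^ (1 - q)) := by rw [hpow]; field_simp
      _ ≤ _ := by gcongr
  have hrest : 0 ≤ (8 * B * α + 2 * B * α / γ₀) * (√(T * γ) * (T : ℝ) ^ ((3 / 2 - q) / 2)) := by
    positivity
  linarith

end Regret

/-! ### Asymptotic equivalence -/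

section Asymptotics

open Topology

/-- By `γ T ≤ T` and `betaIGP ≥ B > 0`, the terms with factor `C` are negligible. -/
lemma isEquivalent_regretBound {B R δ q C : ℝ} {γ : ℕ → ℝ} (hB : 0 < B) (hR : 0 ≤ R)
    (hq : 3 / 2 < q) (hC : 0 ≤ C) (hγ_pos : ∀ T, 1 ≤ T → 0 < γ T) (hγ_le : ∀ T, γ T ≤ T) :
    Asymptotics.IsEquivalent atTop (fun T : ℕ => regretBound B R δ q C γ T)
      (fun T : ℕ => 4 * betaIGP B R δ (γ T) * √(γ T * (T + 2))) := by
  have hβ : ∀ T, B ≤ betaIGP B R δ (γ T) := fun T => betaIGP_ge hR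
  have hv : ∀ T : ℕ, 1 ≤ T → 0 < 4 * betaIGP B R δ (γ T) * √(γ T * (T + 2)) := fun T hT => by
    have h1 := hγ_pos T hT
    have h2 := hB.trans_le (hβ T)
    positivity
  refine Asymptotics.isEquivalent_of_tendsto_one ?_
  -- the quotient is `√(T / (T + 2))` plus a remainder that tends to `0`
  have hrem : Tendsto (fun T : ℕ => C / (4 * B) *
      ((T : ℝ) ^ ((3 / 2 - q) / 2) + (T : ℝ) ^ (1 - q))) atTop (𝓝 0) := by
    have h1 : Tendsto (fun T : ℕ => (T : ℝ) ^ ((3 / 2 - q) / 2)) atTop (𝓝 0) := by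
      have := (tendsto_rpow_neg_atTop (y := (q - 3 / 2) / 2) (by linarith)).comp
        (tendsto_natCast_atTop_atTop (R := ℝ))
      refine this.congr fun T => ?_
      simp only [Function.comp]
      congr 1; ring
    have h2 : Tendsto (fun T : ℕ => (T : ℝ) ^ (1 - q)) atTop (𝓝 0) := by
      have := (tendsto_rpow_neg_atTop (y := q - 1) (by linarith)).comp
        (tendsto_natCast_atTop_atTop (R := ℝ))
      refine this.congr fun T => ?_
      simp only [Function.comp]
      congr 1; ring
    simpa using (h1.add h2).const_mul (C / (4 * B))
  have hsqrt : Tendsto (fun T : ℕ => √((T : ℝ) / (T + 2))) atTop (𝓝 1) := by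
    simpa using (tendsto_natCast_div_add_atTop (2 : ℝ)).sqrt
  have hupper : Tendsto (fun T : ℕ => √((T : ℝ) / (T + 2)) + C / (4 * B) *
      ((T : ℝ) ^ ((3 / 2 - q) / 2) + (T : ℝ) ^ (1 - q))) atTop (𝓝 1) := by
    simpa only [add_zero] using hsqrt.add hrem
  refine tendsto_of_tendsto_of_tendsto_of_le_of_le' hsqrt hupper ?_ ?_
  all_goals
    filter_upwards [eventually_ge_atTop 1] with T hT
    have hT0 : (0 : ℝ) < T := by exact_mod_cast hT
    have hγ0 := hγ_pos T hT
    have hβT := hβ T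
    have hβ0 : 0 < betaIGP B R δ (γ T) := hB.trans_le hβT
    have hs0 : 0 < √(γ T * (T + 2)) := by positivity
    have hsplit : √(γ T * T) = √(T / (T + 2)) * √(γ T * (T + 2)) := by
      rw [← Real.sqrt_mul (by positivity)]
      congr 1
      field_simp
    rw [Pi.div_apply, regretBound]
  · rw [le_div_iff₀ (hv T hT), hsplit]
    have : 0 ≤ C * (√(T * γ T) * (T : ℝ) ^ ((3 / 2 - q) / 2) + γ T * (T : ℝ) ^ (1 - q)) := by
      positivity
    linarith
  · rw [div_le_iff₀ (hv T hT), hsplit, add_mul]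
    have h1 : √(T * γ T) ≤ √(γ T * (T + 2)) := Real.sqrt_le_sqrt (by nlinarith)
    have h2 : γ T ≤ √(γ T * (T + 2)) := Real.le_sqrt_of_sq_le (by nlinarith [hγ_le T])
    have h3 : C * (√(T * γ T) * (T : ℝ) ^ ((3 / 2 - q) / 2) + γ T * (T : ℝ) ^ (1 - q)) ≤
        C / (4 * B) * ((T : ℝ) ^ ((3 / 2 - q) / 2) + (T : ℝ) ^ (1 - q)) *
          (4 * betaIGP B R δ (γ T) * √(γ T * (T + 2))) := by
      calc _ ≤ C * (√(γ T * (T + 2)) * (T : ℝ) ^ ((3 / 2 - q) / 2) +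
            √(γ T * (T + 2)) * (T : ℝ) ^ (1 - q)) := by gcongr
        _ = C / (4 * B) * ((T : ℝ) ^ ((3 / 2 - q) / 2) + (T : ℝ) ^ (1 - q)) *
          (4 * B * √(γ T * (T + 2))) := by field_simp
        _ ≤ _ := by gcongr
    linarith

end Asymptotics

end RKHSBandit

theorem mainTheorem4 {d : ℕ} (Ω : Set (EuclideanSpace ℝ (Fin d)))
    -- the kernel
    (K : Ω → Ω → ℝ) (hK : IsPosDefKernel K) (hK_le : ∀ x, K x x ≤ 1)
    (hK_meas : ∀ y, Measurable fun x => K x y)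
    -- its reproducing kernel Hilbert space
    {H : Type*} [NormedAddCommGroup H] [InnerProductSpace ℝ H] [CompleteSpace H]
    [RKHS ℝ H Ω ℝ] (hH : ∀ x y, RKHS.kernel H x y 1 = K x y)
    -- the arms and the parameters
    (A : Set Ω) (hA : A.Nonempty)
    (α q B R δ : ℝ) (hα : 0 < α) (hq : 3 / 2 < q) (hB : 0 < B) (hR : 0 ≤ R)
    (hδ : 0 < δ) (hδ_lt : δ < 1) :
    ∃ C : ℝ, 0 ≤ C ∧
      -- with probability at least `1 - δ`, the regret is at most `b(T)`
      (∀ T : ℕ, 1 ≤ T → ∀ f : H, ‖f‖ ≤ B →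
        ∀ (D : ℕ) (ξ : ℕ → Ω), IsPGreedyOutput K A (α / (T : ℝ) ^ q) D ξ →
        ∀ {W : Type*} {mW : MeasurableSpace W} (P : Measure W) [IsProbabilityMeasure P]
          (ℱ : Filtration ℕ mW) (x : ℕ → W → Ω) (η y : ℕ → W → ℝ),
          IsStochasticBandit P ℱ T (fun z => f z) R x η y →
          (∀ ω, IsAPGUCBRun K A T (α / (T : ℝ) ^ q) 1 R B δ D ξ
            (fun t => x t ω) (fun t => y t ω)) →
          1 - δ ≤ P.real {ω | regret A (fun z => f z) T (fun t => x t ω) ≤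
            regretBound B R δ q C (maxInfoGain K A 1) T}) ∧
      -- and `b(T)` is asymptotically equivalent to the regret bound of IGP-UCB
      Asymptotics.IsEquivalent atTop
        (fun T : ℕ => regretBound B R δ q C (maxInfoGain K A 1) T)
        (fun T : ℕ => 4 * betaIGP B R δ (maxInfoGain K A 1 T) *
          √(maxInfoGain K A 1 T * (T + 2))) := by
  obtain ⟨a, ha⟩ := hA
  have ha0 : 0 < K a a := by
    simpa using (hK.2 1 (fun _ => a) fun _ _ _ => Subsingleton.elim _ _).det_pos
  -- `γ₀` is the information gain of a single round, a lower bound for all `γ_T` with `T ≥ 1`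
  set γ₀ := 1 / 2 * Real.log (1 + K a a) with hγ₀
  have hγ₀_pos : 0 < γ₀ := mul_pos one_half_pos (Real.log_pos (by linarith))
  have hγ : ∀ T : ℕ, 1 ≤ T → γ₀ ≤ maxInfoGain K A 1 T := fun T hT => by
    refine le_trans ?_ (log_le_maxInfoGain hH hK_le ha ha0.le T)
    have hT' : (1 : ℝ) ≤ T := by exact_mod_cast hT
    rw [hγ₀]
    gcongr
    nlinarith
  refine ⟨8 * B * α + 2 * B * α / γ₀, by positivity, ?_, ?_⟩
  · intro T hT f hf D ξ hξ W mW P _ ℱ x η y hbandit hrun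
    have hT0 : (0 : ℝ) < T := by exact_mod_cast hT
    have he : 0 < α / (T : ℝ) ^ q := div_pos hα (Real.rpow_pos_of_pos hT0 q)
    have hpos := hξ.powerSq_pos hK he
    obtain ⟨θ, hθ, happrox⟩ := exists_coeff_abs_sub_le hH hpos f
    have hφ := measurable_feature hK_meas ξ D
    -- the noise is the observed reward minus the measurable function `f` of the arm
    have hη_meas : ∀ t ∈ Finset.Icc 1 T, Measurable[ℱ (t + 1)] (η t) := fun t ht => by
      have e : η t = fun ω => y t ω - f (x t ω) := by
        ext ω; rw [hbandit.reward_eq t ht ω]; ring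
      rw [e]
      exact (hbandit.reward_measurable t ht).sub ((measurable_of_measurable_kernel hH hK_meas f).comp
        ((hbandit.arm_measurable t ht).mono (ℱ.mono (Nat.le_succ t)) le_rfl))
    have key := one_sub_le_measureReal_noiseSum_le (P := P) (ℱ := ℱ)
      (v := fun t ω => feature K ξ D (x t ω)) (η := η)
      (fun t ht => hφ.comp (hbandit.arm_measurable t ht)) hη_meas hR hbandit.noise_integrable
      hbandit.noise_subGaussian hδ
    refine key.trans (measureReal_mono fun ω hω => ?_)
    refine (regret_le_psi_mul ⟨a, ha⟩ he.le hR hB.le hδ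
      (hθ.trans (pow_le_pow_left₀ (norm_nonneg f) hf 2)) (fun z hz => ?_)
      (fun t ht => hbandit.reward_eq t ht ω) (hrun ω) hω).trans ?_
    · refine (happrox z).trans (mul_le_mul hf ?_ (Real.sqrt_nonneg _) hB.le)
      exact Real.sqrt_le_iff.mpr ⟨he.le, (hξ.terminated z hz).le⟩
    · exact psi_mul_beta_le_regretBound hT hα.le hB.le hR hδ hγ₀_pos (hγ T hT)
        (fun t _ => (feature_dotProduct_self_le hH hpos _).trans (hK_le _))
        (log_det_gram_le_maxInfoGain hH hK_le hpos fun t ht => (hrun ω t ht).1)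
  · refine isEquivalent_regretBound hB hR hq (by positivity)
      (fun T hT => hγ₀_pos.trans_le (hγ T hT)) fun T => ?_
    have := maxInfoGain_le hH hK_le ⟨a, ha⟩ T
    linarith [Nat.cast_nonneg (α := ℝ) T]
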